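/- Let $d,T\ge 1$. Write $\mathcal S_+^d$ for the symmetric positive semidefinite real $d\times d$ matrices, $\preceq$ for the Loewner order and $\langle A,B\rangle=\mathrm{Tr}(A^\top B)$. Let $\mathcal H=\mathcal S_+^d\cap\mathcal K$, where $\mathcal K$ is a set of real $d\times d$ matrices that contains $I_d$ and is closed under scalar multiplication, addition and matrix multiplication (a well-structured preconditioner set). In infima and minima of expressions in $H^{-1}$ over $\mathcal H$, only invertible $H$ are considered. For $x\in\mathbb R^d$ put $\|x\|_H=\sqrt{x^\top Hx}$ and $\|x\|_{\mathcal H}=\sup_{H\in\mathcal H,\,\mathrm{Tr}H\le1}\|x\|_H$. Let $\mathcal X\subseteq\mathbb R^d$ be convex and bounded, and put $\|\mathcal X\|_{\mathcal H}=\sup_{x\in\mathcal X}\|x\|_{\mathcal H}$. **Losses.** Let $L_1,\dots,L_T:\mathbb R^d\to\mathbb R$ be independent random functions, each convex and differentiable. Let $L:\mathbb R^d\to\mathbb R$ and $\Sigma\in\mathcal S_+^d$ be such that, for every $t$ and every $x\in\mathcal X$, $L_t(x)$ is integrable with $\mathbb E[L_t(x)]=L(x)$, and $\nabla L_t(x)-\nabla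 L(x)$ has finite second moments with $$\mathbb E\big[(\nabla L_t(x)-\nabla L(x))(\nabla L_t(x)-\nabla L(x))^\top\big]\preceq\Sigma .$$ Assume that $L$ is twice differentiable on $\mathbb R^d$ and that some $H^*\in\mathcal H$ satisfies $-H^*\preceq\nabla^2L(x)\preceq H^*$ for all $x\in\mathbb R^d$; let $H(L,\mathcal H)$ be the smallest trace of such an $H^*$ (the $\mathcal H$-smoothness of $L$). Assume that $L$ has a global minimizer $x^*$ over $\mathbb R^d$ with $x^*\in\mathcal X$. **Algorithm (AdaReg).** Let $\epsilon>0$, $\eta=\sqrt2\,\|\mathcal X\|_{\mathcal H}$, $x_1\in\mathcal X$ and $M_0=\epsilon I_d$. For $t=1,\dots,T$ let $g_t=\nabla L_t(x_t)$, $M_t=M_{t-1}+g_tg_t^\top$, $$H_t=\operatorname*{arg\,min}_{H\in\mathcal H}\ \langle M_t,H^{-1}\rangle+\eta^2\,\mathrm{Tr}(H),\qquad x_{t+1}=\operatorname*{arg\,min}_{x\in\mathcal X}\ \|x_t-H_t^{-1}g_t-x\|_{H_t},$$ where the minima are supposed to be attained. **Theorem.** With $\bar x_{1:T}=\frac1T\sum_{t=1}^Tx_t$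 and $\sigma=\inf_{H\in\mathcal H,\,\mathrm{Tr}H\le1}\sqrt{\langle\Sigma,H^{-1}\rangle}$, the random variable $L(\bar x_{1:T})-L(x^*)$ is integrable and $$\mathbb E\big[L(\bar x_{1:T})-L(x^*)\big]\le\frac{16}{T}\|\mathcal X\|_{\mathcal H}^2\,H(L,\mathcal H)+\frac{4\sqrt2}{\sqrt T}\|\mathcal X\|_{\mathcal H}\,\sigma+\frac{4\sqrt2\,d\sqrt\epsilon}{T}\|\mathcal X\|_{\mathcal H}.$$ -/

import Mathlib

noncomputable section

namespace AdaReg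

open Matrix

/-- The Frobenius inner product `⟨A, B⟩ = Tr(Aᵀ B)`. -/
def frobInner {d : ℕ} (A B : Matrix (Fin d) (Fin d) ℝ) : ℝ := (Aᵀ * B).trace

/-- The Loewner order `A ⪯ B`. -/
def LoewnerLE {d : ℕ} (A B : Matrix (Fin d) (Fin d) ℝ) : Prop := (B - A).PosSemidef

/-- `𝓗` is a well-structured preconditioner set: the positive semidefinite members of a matrix
subalgebra. A `Subalgebra` contains the identity matrix; it need not be closed under transposes. -/
def IsWellStructured {d : ℕ} (𝓗 : Set (Matrix (Fin d) (Fin d) ℝ)) : Prop :=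
  ∃ K : Subalgebra ℝ (Matrix (Fin d) (Fin d) ℝ), 𝓗 = {H | H.PosSemidef ∧ H ∈ K}

/-- `‖x‖_H = √(xᵀ H x)` for a matrix `H`. -/
def matNorm {d : ℕ} (H : Matrix (Fin d) (Fin d) ℝ) (x : EuclideanSpace ℝ (Fin d)) : ℝ :=
  √(x.ofLp ⬝ᵥ (H *ᵥ x.ofLp))

/-- `‖x‖_𝓗 = sup {‖x‖_H : H ∈ 𝓗, Tr H ≤ 1}` for a set of matrices `𝓗`. -/
def setNorm {d : ℕ} (𝓗 : Set (Matrix (Fin d) (Fin d) ℝ)) (x : EuclideanSpace ℝ (Fin d)) : ℝ :=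
  sSup ((fun H => matNorm H x) '' {H | H ∈ 𝓗 ∧ H.trace ≤ 1})

/-- `‖X‖_𝓗 = sup {‖x‖_𝓗 : x ∈ X}` for a set of vectors `X`. -/
def domainNorm {d : ℕ} (𝓗 : Set (Matrix (Fin d) (Fin d) ℝ))
    (X : Set (EuclideanSpace ℝ (Fin d))) : ℝ :=
  sSup (setNorm 𝓗 '' X)

/-- The Hessian matrix of `f` at `x`. -/
def hessian {d : ℕ} (f : EuclideanSpace ℝ (Fin d) → ℝ) (x : EuclideanSpace ℝ (Fin d)) :
    Matrix (Fin d) (Fin d) ℝ :=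
  Matrix.of fun i j => fderiv ℝ (fderiv ℝ f) x
    (EuclideanSpace.single i (1 : ℝ)) (EuclideanSpace.single j (1 : ℝ))

/-- `f` is twice differentiable on the whole space, `Hs ∈ 𝓗`, and `-Hs ⪯ ∇²f(x) ⪯ Hs`
for every `x`. -/
def IsSmoothnessMatrix {d : ℕ} (f : EuclideanSpace ℝ (Fin d) → ℝ)
    (𝓗 : Set (Matrix (Fin d) (Fin d) ℝ)) (Hs : Matrix (Fin d) (Fin d) ℝ) : Prop :=
  Differentiable ℝ f ∧ Differentiable ℝ (fderiv ℝ f) ∧ Hs ∈ 𝓗 ∧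
    ∀ x, LoewnerLE (-Hs) (hessian f x) ∧ LoewnerLE (hessian f x) Hs

/-- The `𝓗`-smoothness of `f`: the least trace of a matrix of `𝓗` that bounds the Hessian.
Meaningful when such a matrix exists. -/
def smoothness {d : ℕ} (f : EuclideanSpace ℝ (Fin d) → ℝ)
    (𝓗 : Set (Matrix (Fin d) (Fin d) ℝ)) : ℝ :=
  sInf (Matrix.trace '' {Hs | IsSmoothnessMatrix f 𝓗 Hs})

/-- `inf {√⟨S, H⁻¹⟩ : H ∈ 𝓗, Tr H ≤ 1}`; the infimum runs over the invertible `H`,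
which are the positive definite ones. -/
def noiseLevel {d : ℕ} (𝓗 : Set (Matrix (Fin d) (Fin d) ℝ))
    (S : Matrix (Fin d) (Fin d) ℝ) : ℝ :=
  sInf ((fun H => √(frobInner S H⁻¹)) '' {H | H ∈ 𝓗 ∧ H.PosDef ∧ H.trace ≤ 1})

/-- `H` attains the minimum of `⟨M, H⁻¹⟩ + η² Tr H` over the invertible `H ∈ 𝓗`. -/
def IsPreconditioner {d : ℕ} (𝓗 : Set (Matrix (Fin d) (Fin d) ℝ)) (η : ℝ)
    (M H : Matrix (Fin d) (Fin d) ℝ) : Prop :=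
  (H ∈ 𝓗 ∧ H.PosDef) ∧
    IsMinOn (fun H' => frobInner M H'⁻¹ + η ^ 2 * H'.trace) {H' | H' ∈ 𝓗 ∧ H'.PosDef} H

/-- `y` is the projection of `u` onto `X` with respect to `‖·‖_H`. -/
def IsProjection {d : ℕ} (X : Set (EuclideanSpace ℝ (Fin d))) (H : Matrix (Fin d) (Fin d) ℝ)
    (u y : EuclideanSpace ℝ (Fin d)) : Prop :=
  y ∈ X ∧ IsMinOn (fun z => matNorm H (u - z)) X y

/-- `M_t = ε I + ∑_{s ≤ t} g_s g_sᵀ`, with `g_s = ∇ℓ_s(x_s)`. -/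
def gradGram {d T : ℕ} (ε : ℝ) (ℓ : Fin T → EuclideanSpace ℝ (Fin d) → ℝ)
    (x : Fin (T + 1) → EuclideanSpace ℝ (Fin d)) (t : Fin T) : Matrix (Fin d) (Fin d) ℝ :=
  ε • (1 : Matrix (Fin d) (Fin d) ℝ) + ∑ s ∈ Finset.Iic t,
    vecMulVec (gradient (ℓ s) (x s.castSucc)).ofLp (gradient (ℓ s) (x s.castSucc)).ofLp

/-- `x` is the sequence of iterates of AdaReg on the losses `ℓ` (times are counted from `0`):
it starts at `x₁`, and `x_{t+1}` is the projection of `x_t - H_t⁻¹ g_t` onto `X` with respect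
to `‖·‖_{H_t}`, where `H_t` minimizes `⟨M_t, H⁻¹⟩ + η² Tr H` over `𝓗`. -/
def IsRun {d T : ℕ} (𝓗 : Set (Matrix (Fin d) (Fin d) ℝ)) (X : Set (EuclideanSpace ℝ (Fin d)))
    (ε η : ℝ) (x₁ : EuclideanSpace ℝ (Fin d)) (ℓ : Fin T → EuclideanSpace ℝ (Fin d) → ℝ)
    (x : Fin (T + 1) → EuclideanSpace ℝ (Fin d)) : Prop :=
  x 0 = x₁ ∧ ∀ t : Fin T, ∃ H : Matrix (Fin d) (Fin d) ℝ,
    IsPreconditioner 𝓗 η (gradGram ε ℓ x t) H ∧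
      IsProjection X H
        (x t.castSucc - WithLp.toLp 2 (H⁻¹ *ᵥ (gradient (ℓ t) (x t.castSucc)).ofLp)) (x t.succ)

/-- On `X` the random function `ℓ` has expectation `L`, and the second moment matrix of
`∇ℓ(x) - ∇L(x)` exists and is at most `S` in the Loewner order. -/
def NoiseBounded {d : ℕ} {Ω : Type*} [MeasurableSpace Ω] (μ : MeasureTheory.Measure Ω)
    (X : Set (EuclideanSpace ℝ (Fin d))) (L : EuclideanSpace ℝ (Fin d) → ℝ)
    (S : Matrix (Fin d) (Fin d) ℝ) (ℓ : Ω → EuclideanSpace ℝ (Fin d) → ℝ) : Prop :=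
  ∀ x ∈ X,
    MeasureTheory.Integrable (fun ω => ℓ ω x) μ ∧
    ∫ ω, ℓ ω x ∂μ = L x ∧
    (∀ i j, MeasureTheory.Integrable (fun ω =>
      (gradient (ℓ ω) x - gradient L x) i * (gradient (ℓ ω) x - gradient L x) j) μ) ∧
    LoewnerLE (Matrix.of fun i j => ∫ ω,
      (gradient (ℓ ω) x - gradient L x) i * (gradient (ℓ ω) x - gradient L x) j ∂μ) S

end AdaReg

end

/-! The proof is a pathwise regret bound, followed by one well-chosen comparison preconditioner and
an expectation.

Regret. A projected step in the norm of `H_t` gives the usual telescoping inequality. The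
preconditioners increase, since `η² H_t²` and `M_t` have the same trace pairing with the symmetric
elements of `K`, and a weak form of operator monotonicity of the square root applies
(`posSemidef_sub_of_sq`). The increments are therefore positive semidefinite elements of `K`, and
the changes of norm cost at most `2η²` times the last trace. The terms `g_tᵀ H_t⁻¹ g_t` are summed
by a be-the-leader argument. At a minimizer the two summands of the objective coincide, so the
regret is at most the minimum of the last objective, hence at most its value at any competitor
(`IsRun.regret_le`).

Competitor. Take `c₁ I + c₂ H₂ + 4 H₃`, with `H₂` for the noise and `H₃` bounding the Hessian. Joint
convexity of `aᵀ H⁻¹ a` separates `g_t` into noise and `∇L(x_t)`. Smoothness and global minimality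
give `∇Lᵀ H₃⁻¹ ∇L ≤ 2 (L - L(xs))`, so the factor `4` leaves half of the excess, which is absorbed
on the left.

Expectation. `x_t` is independent of the loss at time `t`, so it can be frozen. Convexity of each
loss bounds the expected excess by the expected regret terms, without differentiating under the
integral. Jensen's inequality, the choice of `c₁` and `c₂`, and two infima conclude. Independence
needs the iterates to be measurable; this follows from the uniqueness of both minimizers. -/

noncomputable section
namespace AdaReg
open Matrix

/-! ### Linear algebra of positive semidefinite matrices. -/

section LinearAlgebra

variable {d : ℕ}

theorem PosSemidef.quad_nonneg {H : Matrix (Fin d) (Fin d) ℝ} (hH : H.PosSemidef)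
    (v : Fin d → ℝ) : 0 ≤ v ⬝ᵥ (H *ᵥ v) := by
  simpa using hH.dotProduct_mulVec_nonneg v

theorem PosDef.mulVec_inv {H : Matrix (Fin d) (Fin d) ℝ} (hH : H.PosDef) (v : Fin d → ℝ) :
    H *ᵥ (H⁻¹ *ᵥ v) = v := by
  rw [mulVec_mulVec, mul_nonsing_inv _ ((isUnit_iff_isUnit_det _).1 hH.isUnit), one_mulVec]

theorem IsHermitian.dotProduct_mulVec_comm {H : Matrix (Fin d) (Fin d) ℝ} (hH : H.IsHermitian)
    (v w : Fin d → ℝ) : v ⬝ᵥ (H *ᵥ w) = w ⬝ᵥ (H *ᵥ v) := by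
  have h : Hᵀ = H := by simpa [IsHermitian] using hH
  rw [dotProduct_mulVec, ← mulVec_transpose, h, dotProduct_comm]

/-- Polynomials in a symmetric matrix act diagonally in its eigenbasis. -/
theorem aeval_mul_eigenvectorUnitary {D : Matrix (Fin d) (Fin d) ℝ} (hD : D.IsHermitian)
    (p : Polynomial ℝ) :
    Polynomial.aeval D p * (hD.eigenvectorUnitary : Matrix (Fin d) (Fin d) ℝ) =
      (hD.eigenvectorUnitary : Matrix (Fin d) (Fin d) ℝ) *
        diagonal fun i => p.eval (hD.eigenvalues i) := by
  have hDU : D * (hD.eigenvectorUnitary : Matrix (Fin d) (Fin d) ℝ) =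
      (hD.eigenvectorUnitary : Matrix (Fin d) (Fin d) ℝ) * diagonal hD.eigenvalues := by
    ext i j
    have h := congrFun (hD.mulVec_eigenvectorBasis j) i
    rw [mul_diagonal, mul_apply]
    simpa [mulVec, dotProduct, mul_comm] using h
  induction p using Polynomial.induction_on with
  | C a =>
    ext i j
    simp [Algebra.algebraMap_eq_smul_one, mul_diagonal, mul_comm]
  | add p q hp hq =>
    rw [map_add, add_mul, hp, hq, ← mul_add, diagonal_add]
    simp
  | monomial n a h =>
    have e : (Polynomial.C a * Polynomial.X ^ (n + 1) : Polynomial ℝ) =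
        (Polynomial.C a * Polynomial.X ^ n) * Polynomial.X := by ring
    rw [e, map_mul, Polynomial.aeval_X, mul_assoc, hDU, ← mul_assoc, h, mul_assoc,
      diagonal_mul_diagonal]
    simp

/-- If `H₂² - H₁²` is nonnegative against the positive semidefinite members of a matrix algebra
containing `H₁, H₂`, then `H₁ ⪯ H₂`. -/
theorem posSemidef_sub_of_sq {K : Subalgebra ℝ (Matrix (Fin d) (Fin d) ℝ)}
    {H₁ H₂ : Matrix (Fin d) (Fin d) ℝ} (h₁ : H₁.PosDef) (h₂ : H₂.PosDef) (k₁ : H₁ ∈ K)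
    (k₂ : H₂ ∈ K)
    (h : ∀ B ∈ K, B.PosSemidef → 0 ≤ (B * (H₂ * H₂ - H₁ * H₁)).trace) :
    (H₂ - H₁).PosSemidef := by
  classical
  set D := H₂ - H₁ with hDdef
  have hD : D.IsHermitian := h₂.isHermitian.sub h₁.isHermitian
  rw [hD.posSemidef_iff_eigenvalues_nonneg]
  intro i₀
  by_contra hneg
  simp only [Pi.zero_apply, not_le] at hneg
  set U := (hD.eigenvectorUnitary : Matrix (Fin d) (Fin d) ℝ) with hU
  have hUU : Uᴴ * U = 1 := Unitary.coe_star_mul_self hD.eigenvectorUnitary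
  have hUU' : U * Uᴴ = 1 := Unitary.coe_mul_star_self hD.eigenvectorUnitary
  -- On the spectrum `p` is the indicator of the negative reals, so `aeval D p` is the spectral
  -- projection onto the negative eigenspaces of `D`. Being a polynomial in `D`, it stays in `K`.
  set p : Polynomial ℝ := Lagrange.interpolate (Finset.univ.image hD.eigenvalues) id
    (fun x => if x < 0 then 1 else 0) with hp
  have hpe : ∀ i, p.eval (hD.eigenvalues i) = if hD.eigenvalues i < 0 then 1 else 0 := by
    intro i
    exact Lagrange.eval_interpolate_at_node (v := id) _ (Set.injOn_id _)
      (Finset.mem_image_of_mem _ (Finset.mem_univ i))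
  set δ : Fin d → ℝ := fun i => p.eval (hD.eigenvalues i) with hδ
  have hδ0 : ∀ i, 0 ≤ δ i := by
    intro i; simp only [hδ, hpe]; split_ifs <;> norm_num
  have hE : Polynomial.aeval D p = U * diagonal δ * Uᴴ := by
    rw [← aeval_mul_eigenvectorUnitary hD p, mul_assoc, hUU', mul_one]
  have hDs : D = U * diagonal hD.eigenvalues * Uᴴ := by
    have := aeval_mul_eigenvectorUnitary hD Polynomial.X
    simp only [Polynomial.aeval_X, Polynomial.eval_X] at this
    rw [← this, mul_assoc, hUU', mul_one]
  have hEK : Polynomial.aeval D p ∈ K := by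
    have := Polynomial.aeval_mem_adjoin_singleton ℝ D (p := p)
    exact Algebra.adjoin_le (by simpa using K.sub_mem k₂ k₁) this
  have hEp : (Polynomial.aeval D p).PosSemidef := by
    rw [hE]
    exact (PosSemidef.diagonal hδ0).mul_mul_conjTranspose_same U
  have key := h _ hEK hEp
  -- Although `H₁` and `H₂` need not commute, each term has `D` at one end. In the eigenbasis of `D`
  -- the trace becomes a sum over negative eigenvalues, weighted by positive diagonal entries of
  -- `H₁` and `H₂`, so it would be negative.
  have e1 : H₂ * H₂ - H₁ * H₁ = H₂ * D + D * H₁ := by rw [hDdef]; noncomm_ring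
  have e2 : (Polynomial.aeval D p * (H₂ * H₂ - H₁ * H₁)).trace =
      ∑ i, δ i * hD.eigenvalues i * ((Uᴴ * H₂ * U) i i + (Uᴴ * H₁ * U) i i) := by
    have a1 : (U * diagonal δ * Uᴴ * (H₂ * (U * diagonal hD.eigenvalues * Uᴴ))).trace =
        (diagonal δ * (Uᴴ * H₂ * U) * diagonal hD.eigenvalues).trace := by
      rw [trace_mul_comm, show H₂ * (U * diagonal hD.eigenvalues * Uᴴ) * (U * diagonal δ * Uᴴ) =
        (H₂ * U * diagonal hD.eigenvalues) * (Uᴴ * U) * diagonal δ * Uᴴ by noncomm_ring, hUU,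
        mul_one, trace_mul_comm _ Uᴴ,
        show Uᴴ * (H₂ * U * diagonal hD.eigenvalues * diagonal δ) =
          (Uᴴ * H₂ * U * diagonal hD.eigenvalues) * diagonal δ by noncomm_ring,
        trace_mul_comm]
      simp only [mul_assoc]
    have a2 : (U * diagonal δ * Uᴴ * (U * diagonal hD.eigenvalues * Uᴴ * H₁)).trace =
        (diagonal δ * diagonal hD.eigenvalues * (Uᴴ * H₁ * U)).trace := by
      rw [show U * diagonal δ * Uᴴ * (U * diagonal hD.eigenvalues * Uᴴ * H₁) =
        U * (diagonal δ * (Uᴴ * U) * diagonal hD.eigenvalues * Uᴴ * H₁) by noncomm_ring, hUU,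
        mul_one, trace_mul_comm]
      simp only [mul_assoc]
    rw [e1, hE, mul_add, trace_add]
    conv_lhs => rw [hDs]
    rw [a1, a2]
    simp only [trace, diag_apply, mul_diagonal, diagonal_mul_diagonal, diagonal_mul,
      ← Finset.sum_add_distrib]
    exact Finset.sum_congr rfl fun i _ => by ring
  have hinj : Function.Injective U.mulVec := by
    intro a b hab
    have := congrArg (fun w => Uᴴ *ᵥ w) hab
    simpa only [mulVec_mulVec, hUU, one_mulVec] using this
  have hpos : ∀ i, 0 < (Uᴴ * H₂ * U) i i + (Uᴴ * H₁ * U) i i := fun i =>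
    add_pos (h₂.conjTranspose_mul_mul_same hinj).diag_pos
      (h₁.conjTranspose_mul_mul_same hinj).diag_pos
  have hneg' : ∑ i, δ i * hD.eigenvalues i * ((Uᴴ * H₂ * U) i i + (Uᴴ * H₁ * U) i i) < 0 := by
    refine Finset.sum_neg' ?_ ⟨i₀, Finset.mem_univ _, ?_⟩
    · intro i _
      apply mul_nonpos_of_nonpos_of_nonneg _ (hpos i).le
      simp only [hδ, hpe]
      split_ifs with hi <;> linarith
    · apply mul_neg_of_neg_of_pos _ (hpos i₀)
      simp only [hδ, hpe, hneg, if_true]; linarith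
  linarith [e2 ▸ key]

theorem quad_vecMulVec (g v : Fin d → ℝ) :
    v ⬝ᵥ (vecMulVec g g *ᵥ v) = (g ⬝ᵥ v) ^ 2 := by
  rw [vecMulVec_mulVec, op_smul_eq_smul, dotProduct_smul, smul_eq_mul, dotProduct_comm v g, sq]

theorem PosSemidef.quad_le_trace_mul {H : Matrix (Fin d) (Fin d) ℝ} (hH : H.PosSemidef)
    (v : Fin d → ℝ) : v ⬝ᵥ (H *ᵥ v) ≤ H.trace * (v ⬝ᵥ v) := by
  obtain ⟨m, V, rfl⟩ := posSemidef_iff_eq_sum_vecMulVec.1 hH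
  simp only [sum_mulVec, dotProduct_sum, trace_sum, Finset.sum_mul, star_trivial]
  refine Finset.sum_le_sum fun i _ => ?_
  rw [quad_vecMulVec, trace_vecMulVec]
  simp only [dotProduct, ← sq]
  exact Finset.sum_mul_sq_le_sq_mul_sq _ _ _

/-- Fenchel's inequality for the quadratic form of a positive definite matrix. -/
theorem PosDef.two_mul_dotProduct_sub_le {H : Matrix (Fin d) (Fin d) ℝ} (hH : H.PosDef)
    (a w : Fin d → ℝ) : 2 * (a ⬝ᵥ w) - w ⬝ᵥ (H *ᵥ w) ≤ a ⬝ᵥ (H⁻¹ *ᵥ a) := by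
  -- `b` maximizes the left side over `w`; the defect is the quadratic form at `w - b`.
  set b := H⁻¹ *ᵥ a
  have hb : H *ᵥ b = a := PosDef.mulVec_inv hH a
  have h := PosSemidef.quad_nonneg hH.posSemidef (w - b)
  rw [mulVec_sub, hb, dotProduct_sub, sub_dotProduct, sub_dotProduct,
    IsHermitian.dotProduct_mulVec_comm hH.isHermitian b w, hb] at h
  rw [dotProduct_comm a b, dotProduct_comm a w]
  linarith

/-- Joint convexity of `(a, H) ↦ aᵀ H⁻¹ a`, with a third summand in the matrix. -/
theorem quad_inv_add_le {H₀ H₁ H₂ : Matrix (Fin d) (Fin d) ℝ} (h₀ : H₀.PosSemidef)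
    (h₁ : H₁.PosDef) (h₂ : H₂.PosDef) (a b : Fin d → ℝ) :
    (a + b) ⬝ᵥ ((H₀ + H₁ + H₂)⁻¹ *ᵥ (a + b)) ≤ a ⬝ᵥ (H₁⁻¹ *ᵥ a) + b ⬝ᵥ (H₂⁻¹ *ᵥ b) := by
  have hH : (H₀ + H₁ + H₂).PosDef := (Matrix.PosDef.posSemidef_add h₀ h₁).add h₂
  -- The maximizer for the sum is used as a test vector in Fenchel's inequality for each summand;
  -- `H₀` only contributes with a favourable sign.
  set w := (H₀ + H₁ + H₂)⁻¹ *ᵥ (a + b)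
  have hw : (H₀ + H₁ + H₂) *ᵥ w = a + b := PosDef.mulVec_inv hH _
  have e : w ⬝ᵥ ((H₀ + H₁ + H₂) *ᵥ w) = (a + b) ⬝ᵥ w := by rw [hw, dotProduct_comm]
  have i1 := PosDef.two_mul_dotProduct_sub_le h₁ a w
  have i2 := PosDef.two_mul_dotProduct_sub_le h₂ b w
  have i0 := PosSemidef.quad_nonneg h₀ w
  simp only [add_mulVec, dotProduct_add, add_dotProduct] at e ⊢
  linarith

theorem frobInner_vecMulVec (g : Fin d → ℝ) (B : Matrix (Fin d) (Fin d) ℝ) :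
    frobInner (vecMulVec g g) B = g ⬝ᵥ (B *ᵥ g) := by
  rw [frobInner, transpose_vecMulVec, vecMulVec_mul, trace_vecMulVec, dotProduct_mulVec,
    dotProduct_comm]

theorem frobInner_add_left (A B C : Matrix (Fin d) (Fin d) ℝ) :
    frobInner (A + B) C = frobInner A C + frobInner B C := by
  simp [frobInner, add_mul]

theorem frobInner_smul_left (c : ℝ) (A C : Matrix (Fin d) (Fin d) ℝ) :
    frobInner (c • A) C = c * frobInner A C := by
  simp [frobInner]

theorem frobInner_smul_right (c : ℝ) (A C : Matrix (Fin d) (Fin d) ℝ) :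
    frobInner A (c • C) = c * frobInner A C := by
  simp [frobInner]

theorem frobInner_one_left (C : Matrix (Fin d) (Fin d) ℝ) : frobInner 1 C = C.trace := by
  simp [frobInner]

theorem frobInner_sum_left {ι : Type*} (s : Finset ι) (A : ι → Matrix (Fin d) (Fin d) ℝ)
    (C : Matrix (Fin d) (Fin d) ℝ) :
    frobInner (∑ i ∈ s, A i) C = ∑ i ∈ s, frobInner (A i) C := by
  simp [frobInner, transpose_sum, Finset.sum_mul, trace_sum]

theorem frobInner_nonneg {A B : Matrix (Fin d) (Fin d) ℝ} (hA : A.PosSemidef)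
    (hB : B.PosSemidef) : 0 ≤ frobInner A B := by
  obtain ⟨m, V, rfl⟩ := posSemidef_iff_eq_sum_vecMulVec.1 hA
  rw [frobInner_sum_left]
  refine Finset.sum_nonneg fun i _ => ?_
  rw [star_trivial, frobInner_vecMulVec]
  exact PosSemidef.quad_nonneg hB _

end LinearAlgebra
-- Optimality conditions and monotonicity of the preconditioner.
section Preconditioner

variable {d : ℕ}

attribute [local instance] Matrix.linftyOpNormedRing Matrix.linftyOpNormedAlgebra

theorem hasDerivAt_matrix_inv {A : ℝ → Matrix (Fin d) (Fin d) ℝ} {A' : Matrix (Fin d) (Fin d) ℝ}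
    {s : ℝ} (hA : HasDerivAt A A' s) (hu : IsUnit (A s)) :
    HasDerivAt (fun r => (A r)⁻¹) (-((A s)⁻¹ * A' * (A s)⁻¹)) s := by
  obtain ⟨u, hu⟩ := hu
  have h1 := hasFDerivAt_ringInverse (𝕜 := ℝ) u
  rw [hu] at h1
  have h2 := h1.comp_hasDerivAt s hA
  simp only [Function.comp_def] at h2
  have e : (↑u⁻¹ : Matrix (Fin d) (Fin d) ℝ) = (A s)⁻¹ := by
    rw [← hu, Matrix.coe_units_inv]
  simp only [nonsing_inv_eq_ringInverse] at e ⊢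
  rw [e] at h2
  exact h2

theorem hasDerivAt_trace_comp_mul {A : ℝ → Matrix (Fin d) (Fin d) ℝ}
    {A' : Matrix (Fin d) (Fin d) ℝ} {s : ℝ} (hA : HasDerivAt A A' s)
    (M : Matrix (Fin d) (Fin d) ℝ) :
    HasDerivAt (fun r => (M * A r).trace) (M * A').trace s := by
  have h := (LinearMap.toContinuousLinearMap
    ((traceLinearMap (Fin d) ℝ ℝ).comp (LinearMap.mulLeft ℝ M))).hasFDerivAt.comp_hasDerivAt s hA
  exact h

/-- First-order optimality: `M - η² H²` is orthogonal to the symmetric part of the algebra. -/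
theorem IsPreconditioner.frobInner_eq {K : Subalgebra ℝ (Matrix (Fin d) (Fin d) ℝ)} {η : ℝ}
    {M H : Matrix (Fin d) (Fin d) ℝ} (hM : M.IsHermitian)
    (h : IsPreconditioner {H | H.PosSemidef ∧ H ∈ K} η M H) {B : Matrix (Fin d) (Fin d) ℝ}
    (hB : B.IsHermitian) (hBK : B ∈ K) :
    (B * M).trace = η ^ 2 * (B * (H * H)).trace := by
  obtain ⟨⟨⟨-, hK⟩, hH⟩, hmin⟩ := h
  have hHt : Hᵀ = H := by simpa [IsHermitian] using hH.isHermitian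
  have hBt : Bᵀ = B := by simpa [IsHermitian] using hB
  have hMt : Mᵀ = M := by simpa [IsHermitian] using hM
  have hHu : IsUnit H.det := (isUnit_iff_isUnit_det _).1 hH.isUnit
  set W : ℝ → Matrix (Fin d) (Fin d) ℝ := fun s => 1 + s • (B * H) with hW
  set W' : ℝ → Matrix (Fin d) (Fin d) ℝ := fun s => 1 + s • (H * B) with hW'
  -- A curve of congruences of `H` stays positive definite near `0`, and stays in `K` without
  -- closure under transposes because both `H * B` and `B * H` lie in `K`. Its velocity `2 H B H` is
  -- chosen so that the inverse has velocity `-2 B`.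
  set A : ℝ → Matrix (Fin d) (Fin d) ℝ := fun s => W' s * H * W s with hA
  have hWW : ∀ s, (W s)ᴴ = W' s := by
    intro s
    simp [hW, hW', hBt, hHt]
  have hWd : HasDerivAt W (B * H) 0 := by
    have h := ((hasDerivAt_id (0 : ℝ)).smul_const (B * H)).const_add 1
    rw [one_smul] at h
    exact h
  have hWd' : HasDerivAt W' (H * B) 0 := by
    have h := ((hasDerivAt_id (0 : ℝ)).smul_const (H * B)).const_add 1
    rw [one_smul] at h
    exact h
  have hA0 : A 0 = H := by simp [hA, hW, hW']
  have hAd : HasDerivAt A (2 • (H * B * H)) 0 := by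
    have := (hWd'.mul_const H).mul hWd
    have e : 2 • (H * B * H) = H * B * H * W 0 + W' 0 * H * (B * H) := by
      simp only [hW, hW', zero_smul, add_zero, one_mul, mul_one, two_nsmul]
      noncomm_ring
    rw [e]
    exact this
  have hev : ∀ᶠ s in nhds (0 : ℝ), A s ∈ {H' | H' ∈ {H | H.PosSemidef ∧ H ∈ K} ∧ H'.PosDef} := by
    have hc : ContinuousAt (fun s => (W s).det) 0 := by
      have : Continuous fun s : ℝ => (W s).det := by
        simp only [hW]
        exact Continuous.matrix_det (by fun_prop)
      exact this.continuousAt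
    have hne : ∀ᶠ s in nhds (0 : ℝ), (W s).det ≠ 0 := by
      apply hc.eventually_ne
      simp [hW]
    filter_upwards [hne] with s hs
    have hP : (A s).PosDef := by
      rw [hA]
      simp only [← hWW]
      refine hH.conjTranspose_mul_mul_same ?_
      exact mulVec_injective_of_isUnit ((isUnit_iff_isUnit_det _).2 (isUnit_iff_ne_zero.2 hs))
    refine ⟨⟨hP.posSemidef, ?_⟩, hP⟩
    exact K.mul_mem (K.mul_mem (K.add_mem K.one_mem (K.smul_mem (K.mul_mem hK hBK) s)) hK)
      (K.add_mem K.one_mem (K.smul_mem (K.mul_mem hBK hK) s))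
  have hlm : IsLocalMin (fun s => frobInner M (A s)⁻¹ + η ^ 2 * (A s).trace) 0 := by
    filter_upwards [hev] with s hs
    have := hmin hs
    simpa [hA0] using this
  have hd1 := hasDerivAt_trace_comp_mul (hasDerivAt_matrix_inv hAd (by rw [hA0]; exact hH.isUnit)) Mᵀ
  have hd2 := (hasDerivAt_trace_comp_mul hAd 1).const_mul (η ^ 2)
  simp only [one_mul] at hd2
  have hd := hlm.hasDerivAt_eq_zero (hd1.add hd2)
  rw [hA0, hMt] at hd
  have e1 : H⁻¹ * (2 • (H * B * H)) * H⁻¹ = 2 • B := by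
    rw [mul_smul_comm, smul_mul_assoc, show H⁻¹ * (H * B * H) * H⁻¹ =
      (H⁻¹ * H) * B * (H * H⁻¹) by noncomm_ring, nonsing_inv_mul _ hHu, mul_nonsing_inv _ hHu]
    simp
  rw [e1, mul_neg, trace_neg, mul_smul_comm, trace_smul, trace_smul, trace_mul_comm M B,
    trace_mul_comm (H * B) H, ← mul_assoc, trace_mul_comm (H * H) B] at hd
  simp only [nsmul_eq_mul, Nat.cast_ofNat] at hd
  linarith

theorem inv_smul_of_posDef {c : ℝ} (hc : c ≠ 0) {H : Matrix (Fin d) (Fin d) ℝ} (hH : H.PosDef) :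
    (c • H)⁻¹ = c⁻¹ • H⁻¹ := by
  have hu : IsUnit H.det := (isUnit_iff_isUnit_det _).1 hH.isUnit
  apply inv_eq_left_inv
  rw [smul_mul_smul_comm, inv_mul_cancel₀ hc, nonsing_inv_mul _ hu, one_smul]

theorem frobInner_inv_smul {c : ℝ} (hc : c ≠ 0) (M : Matrix (Fin d) (Fin d) ℝ)
    {H : Matrix (Fin d) (Fin d) ℝ} (hH : H.PosDef) :
    frobInner M (c • H)⁻¹ = c⁻¹ * frobInner M H⁻¹ := by
  rw [inv_smul_of_posDef hc hH, frobInner_smul_right]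

/-- The two summands of the objective agree at its minimizer. -/
theorem IsPreconditioner.frobInner_inv_eq {K : Subalgebra ℝ (Matrix (Fin d) (Fin d) ℝ)} {η : ℝ}
    {M H : Matrix (Fin d) (Fin d) ℝ}
    (h : IsPreconditioner {H | H.PosSemidef ∧ H ∈ K} η M H) :
    frobInner M H⁻¹ = η ^ 2 * H.trace := by
  obtain ⟨⟨⟨hH0, hK⟩, hH⟩, hmin⟩ := h
  -- Stationarity along the ray `c • H` at `c = 1` balances the two summands.
  have hlm : IsLocalMin (fun c : ℝ => c⁻¹ * frobInner M H⁻¹ + η ^ 2 * (c * H.trace)) 1 := by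
    filter_upwards [lt_mem_nhds (zero_lt_one : (0 : ℝ) < 1)] with c hc
    have := hmin (show c • H ∈ {H' | H' ∈ {H | H.PosSemidef ∧ H ∈ K} ∧ H'.PosDef} from
      ⟨⟨hH0.smul hc.le, K.smul_mem hK c⟩, hH.smul hc⟩)
    simpa [frobInner_inv_smul hc.ne' M hH] using this
  have hd1 := (hasDerivAt_inv (one_ne_zero (α := ℝ))).mul_const (frobInner M H⁻¹)
  have hd2 := ((hasDerivAt_id (1 : ℝ)).mul_const H.trace).const_mul (η ^ 2)
  have := hlm.hasDerivAt_eq_zero (hd1.add hd2)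
  simp at this
  linarith

/-- Preconditioners are monotone in the matrix they are built from. -/
theorem IsPreconditioner.mono {K : Subalgebra ℝ (Matrix (Fin d) (Fin d) ℝ)} {η : ℝ} (hη : 0 < η)
    {M₁ M₂ H₁ H₂ : Matrix (Fin d) (Fin d) ℝ} (hM₁ : M₁.IsHermitian) (hM₂ : M₂.IsHermitian)
    (h₁ : IsPreconditioner {H | H.PosSemidef ∧ H ∈ K} η M₁ H₁)
    (h₂ : IsPreconditioner {H | H.PosSemidef ∧ H ∈ K} η M₂ H₂)
    (hle : (M₂ - M₁).PosSemidef) : (H₂ - H₁).PosSemidef := by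
  refine posSemidef_sub_of_sq h₁.1.2 h₂.1.2 h₁.1.1.2 h₂.1.1.2 fun B hBK hB => ?_
  have e1 := h₁.frobInner_eq hM₁ hB.isHermitian hBK
  have e2 := h₂.frobInner_eq hM₂ hB.isHermitian hBK
  have h := frobInner_nonneg hB hle
  have hBt : Bᵀ = B := by simpa [IsHermitian] using hB.isHermitian
  rw [frobInner, hBt, mul_sub, trace_sub, e1, e2, ← mul_sub, ← trace_sub, ← mul_sub] at h
  exact nonneg_of_mul_nonneg_right h (by positivity)

end Preconditioner
-- Quadratic forms on the domain.
section Norms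

variable {d : ℕ}

theorem matNorm_sq {H : Matrix (Fin d) (Fin d) ℝ} (hH : H.PosSemidef)
    (x : EuclideanSpace ℝ (Fin d)) : matNorm H x ^ 2 = x.ofLp ⬝ᵥ (H *ᵥ x.ofLp) :=
  Real.sq_sqrt (PosSemidef.quad_nonneg hH _)

theorem dotProduct_self_eq_norm_sq (x : EuclideanSpace ℝ (Fin d)) :
    x.ofLp ⬝ᵥ x.ofLp = ‖x‖ ^ 2 := by
  rw [EuclideanSpace.real_norm_sq_eq, dotProduct]
  exact Finset.sum_congr rfl fun i _ => (sq _).symm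

theorem matNorm_le_norm {H : Matrix (Fin d) (Fin d) ℝ} (hH : H.PosSemidef) (htr : H.trace ≤ 1)
    (x : EuclideanSpace ℝ (Fin d)) : matNorm H x ≤ ‖x‖ := by
  refine Real.sqrt_le_iff.2 ⟨norm_nonneg _, ?_⟩
  have h := PosSemidef.quad_le_trace_mul hH x.ofLp
  rw [dotProduct_self_eq_norm_sq] at h
  nlinarith [sq_nonneg ‖x‖]

variable {K : Subalgebra ℝ (Matrix (Fin d) (Fin d) ℝ)} {X : Set (EuclideanSpace ℝ (Fin d))}

theorem matNorm_le_setNorm {H : Matrix (Fin d) (Fin d) ℝ} (hH : H.PosSemidef) (hK : H ∈ K)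
    (htr : H.trace ≤ 1) (x : EuclideanSpace ℝ (Fin d)) :
    matNorm H x ≤ setNorm {H | H.PosSemidef ∧ H ∈ K} x := by
  refine le_csSup ⟨‖x‖, ?_⟩ ⟨H, ⟨⟨hH, hK⟩, htr⟩, rfl⟩
  rintro _ ⟨H', ⟨⟨hH', -⟩, htr'⟩, rfl⟩
  exact matNorm_le_norm hH' htr' x

theorem setNorm_le_norm (x : EuclideanSpace ℝ (Fin d)) :
    setNorm {H | H.PosSemidef ∧ H ∈ K} x ≤ ‖x‖ := by
  refine Real.sSup_le ?_ (norm_nonneg _)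
  rintro _ ⟨H', ⟨⟨hH', -⟩, htr'⟩, rfl⟩
  exact matNorm_le_norm hH' htr' x

theorem setNorm_le_domainNorm (hX : Bornology.IsBounded X) {x : EuclideanSpace ℝ (Fin d)}
    (hx : x ∈ X) : setNorm {H | H.PosSemidef ∧ H ∈ K} x ≤
      domainNorm {H | H.PosSemidef ∧ H ∈ K} X := by
  obtain ⟨R, hR⟩ := hX.exists_norm_le
  refine le_csSup ⟨R, ?_⟩ ⟨x, hx, rfl⟩
  rintro _ ⟨y, hy, rfl⟩
  exact (setNorm_le_norm y).trans (hR y hy)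

theorem domainNorm_nonneg (𝓗 : Set (Matrix (Fin d) (Fin d) ℝ)) : 0 ≤ domainNorm 𝓗 X := by
  refine Real.sSup_nonneg ?_
  rintro _ ⟨x, -, rfl⟩
  refine Real.sSup_nonneg ?_
  rintro _ ⟨H, -, rfl⟩
  exact Real.sqrt_nonneg _

/-- Normalizing `H` to trace one makes it admissible in the supremum. If the trace vanishes, so does
the quadratic form. -/
theorem quad_le_trace_mul_domainNorm (hX : Bornology.IsBounded X)
    {H : Matrix (Fin d) (Fin d) ℝ} (hH : H.PosSemidef) (hK : H ∈ K)
    {x : EuclideanSpace ℝ (Fin d)} (hx : x ∈ X) :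
    x.ofLp ⬝ᵥ (H *ᵥ x.ofLp) ≤ H.trace * domainNorm {H | H.PosSemidef ∧ H ∈ K} X ^ 2 := by
  rcases hH.trace_nonneg.eq_or_lt with h0 | hpos
  · have h := PosSemidef.quad_le_trace_mul hH x.ofLp
    rw [← h0] at h ⊢
    linarith
  · have hs : (H.trace⁻¹ • H).PosSemidef := hH.smul (inv_nonneg.2 hpos.le)
    have h1 := (matNorm_le_setNorm hs (K.smul_mem hK _)
      (by rw [trace_smul, smul_eq_mul, inv_mul_cancel₀ hpos.ne']) x).trans
      (setNorm_le_domainNorm hX hx)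
    have h2 := pow_le_pow_left₀ (Real.sqrt_nonneg _) h1 2
    rw [← matNorm, matNorm_sq hs, smul_mulVec, dotProduct_smul, smul_eq_mul,
      inv_mul_le_iff₀ hpos] at h2
    exact h2

/-- The parallelogram identity gives twice the sum of the two forms, hence the factor `4`. Only
membership in `K` is needed, so differences of preconditioners qualify. -/
theorem quad_sub_le_trace_mul_domainNorm (hX : Bornology.IsBounded X)
    {H : Matrix (Fin d) (Fin d) ℝ} (hH : H.PosSemidef) (hK : H ∈ K)
    {x y : EuclideanSpace ℝ (Fin d)} (hx : x ∈ X) (hy : y ∈ X) :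
    (x - y).ofLp ⬝ᵥ (H *ᵥ (x - y).ofLp) ≤
      4 * domainNorm {H | H.PosSemidef ∧ H ∈ K} X ^ 2 * H.trace := by
  have h1 := quad_le_trace_mul_domainNorm hX hH hK hx
  have h2 := quad_le_trace_mul_domainNorm hX hH hK hy
  have h3 := PosSemidef.quad_nonneg hH (x + y).ofLp
  simp only [WithLp.ofLp_sub, WithLp.ofLp_add, mulVec_sub, mulVec_add, dotProduct_sub,
    dotProduct_add, sub_dotProduct, add_dotProduct] at h3 ⊢
  linarith

end Norms

/-! ### Projections in a matrix norm. -/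

section Projection

variable {d : ℕ} {X : Set (EuclideanSpace ℝ (Fin d))}

/-- The variational inequality of a projection. -/
theorem IsProjection.variational (hX : Convex ℝ X) {H : Matrix (Fin d) (Fin d) ℝ}
    (hH : H.PosSemidef) {u y z : EuclideanSpace ℝ (Fin d)} (h : IsProjection X H u y)
    (hz : z ∈ X) : (u - y).ofLp ⬝ᵥ (H *ᵥ (z - y).ofLp) ≤ 0 := by
  obtain ⟨hy, hmin⟩ := h
  set a := (u - y).ofLp with ha
  set b := (z - y).ofLp with hb
  have key : ∀ s : ℝ, 0 < s → s ≤ 1 → 2 * (a ⬝ᵥ (H *ᵥ b)) ≤ s * (b ⬝ᵥ (H *ᵥ b)) := by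
    intro s hs hs1
    have hm : y + s • (z - y) ∈ X := hX.add_smul_sub_mem hy hz ⟨hs.le, hs1⟩
    have h1 : matNorm H (u - y) ≤ matNorm H (u - (y + s • (z - y))) := hmin hm
    have h2 := pow_le_pow_left₀ (Real.sqrt_nonneg _) h1 2
    rw [← matNorm, matNorm_sq hH, matNorm_sq hH] at h2
    have e : (u - (y + s • (z - y))).ofLp = a - s • b := by
      simp only [ha, hb, WithLp.ofLp_sub, WithLp.ofLp_add, WithLp.ofLp_smul]
      abel
    rw [e, ← ha] at h2
    simp only [mulVec_sub, mulVec_smul, dotProduct_sub, sub_dotProduct, dotProduct_smul,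
      smul_dotProduct, smul_eq_mul,
      IsHermitian.dotProduct_mulVec_comm hH.isHermitian b a] at h2
    nlinarith
  by_contra hpos
  push Not at hpos
  have hq := PosSemidef.quad_nonneg hH b
  set p := a ⬝ᵥ (H *ᵥ b)
  set q := b ⬝ᵥ (H *ᵥ b)
  have hpq : 0 < p + q := by linarith
  -- This parameter lies in `(0, 1]` even when `q = 0`, and it contradicts `key`.
  have h1 := key (p / (p + q)) (by positivity) (by rw [div_le_one hpq]; linarith)
  rw [div_mul_eq_mul_div, le_div_iff₀ hpq] at h1
  nlinarith

theorem IsProjection.quad_sub_le (hX : Convex ℝ X) {H : Matrix (Fin d) (Fin d) ℝ}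
    (hH : H.PosSemidef) {u y z : EuclideanSpace ℝ (Fin d)} (h : IsProjection X H u y)
    (hz : z ∈ X) :
    (y - z).ofLp ⬝ᵥ (H *ᵥ (y - z).ofLp) ≤ (u - z).ofLp ⬝ᵥ (H *ᵥ (u - z).ofLp) := by
  have h1 := h.variational hX hH hz
  have h2 := PosSemidef.quad_nonneg hH (u - y).ofLp
  have e : (u - z).ofLp = (u - y).ofLp + (y - z).ofLp := by
    simp only [WithLp.ofLp_sub]; abel
  have e' : (z - y).ofLp = -(y - z).ofLp := by
    simp only [WithLp.ofLp_sub]; abel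
  rw [e', mulVec_neg, dotProduct_neg] at h1
  rw [e]
  simp only [mulVec_add, dotProduct_add, add_dotProduct,
    IsHermitian.dotProduct_mulVec_comm hH.isHermitian (y - z).ofLp (u - y).ofLp]
  linarith

/-- One projected step, measured in the norm of a positive definite matrix. -/
theorem IsProjection.two_mul_dotProduct_le (hX : Convex ℝ X) {H : Matrix (Fin d) (Fin d) ℝ}
    (hH : H.PosDef) {x y z : EuclideanSpace ℝ (Fin d)} {g : Fin d → ℝ}
    (h : IsProjection X H (x - WithLp.toLp 2 (H⁻¹ *ᵥ g)) y) (hz : z ∈ X) :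
    2 * (g ⬝ᵥ (x - z).ofLp) + (y - z).ofLp ⬝ᵥ (H *ᵥ (y - z).ofLp) ≤
      (x - z).ofLp ⬝ᵥ (H *ᵥ (x - z).ofLp) + g ⬝ᵥ (H⁻¹ *ᵥ g) := by
  have h1 := h.quad_sub_le hX hH.posSemidef hz
  have e : (x - WithLp.toLp 2 (H⁻¹ *ᵥ g) - z).ofLp = (x - z).ofLp - H⁻¹ *ᵥ g := by
    simp only [WithLp.ofLp_sub]; abel
  rw [e] at h1
  simp only [mulVec_sub, dotProduct_sub, sub_dotProduct, PosDef.mulVec_inv hH,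
    IsHermitian.dotProduct_mulVec_comm hH.isHermitian (H⁻¹ *ᵥ g)] at h1
  simp only [mulVec_sub, dotProduct_sub, sub_dotProduct, WithLp.ofLp_sub] at h1 ⊢
  simp only [dotProduct_comm _ g] at h1 ⊢
  linarith

end Projection

/-! ### Pathwise regret. -/

section Regret

variable {d T : ℕ} {K : Subalgebra ℝ (Matrix (Fin d) (Fin d) ℝ)}
  {X : Set (EuclideanSpace ℝ (Fin d))} {ε η : ℝ} {x₁ : EuclideanSpace ℝ (Fin d)}
  {ℓ : Fin T → EuclideanSpace ℝ (Fin d) → ℝ} {x : Fin (T + 1) → EuclideanSpace ℝ (Fin d)}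

theorem posDef_gradGram (hε : 0 < ε) (t : Fin T) : (gradGram ε ℓ x t).PosDef := by
  refine PosDef.add_posSemidef (PosDef.one.smul hε) (posSemidef_sum _ fun s _ => ?_)
  simpa using posSemidef_vecMulVec_self_star (gradient (ℓ s) (x s.castSucc)).ofLp

theorem Fin.Iic_mk_succ {k : ℕ} (hk : k + 1 < T) :
    Finset.Iic (⟨k + 1, hk⟩ : Fin T) = insert ⟨k + 1, hk⟩ (Finset.Iic ⟨k, by omega⟩) := by
  ext ⟨i, hi⟩
  simp only [Finset.mem_Iic, Finset.mem_insert, Fin.mk_le_mk, Fin.mk.injEq]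
  omega

theorem Fin.Iic_mk_succ_notMem {k : ℕ} (hk : k + 1 < T) :
    (⟨k + 1, hk⟩ : Fin T) ∉ Finset.Iic (⟨k, by omega⟩ : Fin T) := by
  simp

theorem gradGram_succ {k : ℕ} (hk : k + 1 < T) :
    gradGram ε ℓ x ⟨k + 1, hk⟩ = gradGram ε ℓ x ⟨k, by omega⟩ +
      vecMulVec (gradient (ℓ ⟨k + 1, hk⟩) (x (Fin.castSucc ⟨k + 1, hk⟩))).ofLp
        (gradient (ℓ ⟨k + 1, hk⟩) (x (Fin.castSucc ⟨k + 1, hk⟩))).ofLp := by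
  rw [gradGram, Fin.Iic_mk_succ hk, Finset.sum_insert (Fin.Iic_mk_succ_notMem hk), gradGram]
  abel

theorem Fin.Iic_mk_zero (hT : 0 < T) : Finset.Iic (⟨0, hT⟩ : Fin T) = {⟨0, hT⟩} := by
  ext ⟨i, hi⟩
  simp [Fin.mk_le_mk]

theorem IsRun.mem (hx₁ : x₁ ∈ X) {𝓗 : Set (Matrix (Fin d) (Fin d) ℝ)}
    (h : IsRun 𝓗 X ε η x₁ ℓ x) (t : Fin (T + 1)) : x t ∈ X := by
  refine Fin.cases ?_ (fun s => ?_) t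
  · rw [h.1]; exact hx₁
  · obtain ⟨H, -, hp⟩ := h.2 s
    exact hp.1

/-- The regret of AdaReg is at most the minimum of the last objective. -/
theorem IsRun.regret_le (hT : 0 < T) (hX : Convex ℝ X) (hXb : Bornology.IsBounded X)
    (hε : 0 < ε) (hη : 0 < η) (hηD : η = √2 * domainNorm {H | H.PosSemidef ∧ H ∈ K} X)
    (hx₁ : x₁ ∈ X) (h : IsRun {H | H.PosSemidef ∧ H ∈ K} X ε η x₁ ℓ x)
    {z : EuclideanSpace ℝ (Fin d)} (hz : z ∈ X) {H' : Matrix (Fin d) (Fin d) ℝ}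
    (hH' : H'.PosDef) (hK' : H' ∈ K) :
    ∑ t : Fin T, (gradient (ℓ t) (x t.castSucc)).ofLp ⬝ᵥ (x t.castSucc - z).ofLp ≤
      ε * H'⁻¹.trace + ∑ t : Fin T, (gradient (ℓ t) (x t.castSucc)).ofLp ⬝ᵥ
        (H'⁻¹ *ᵥ (gradient (ℓ t) (x t.castSucc)).ofLp) + η ^ 2 * H'.trace := by
  have hmem := h.mem hx₁
  choose H hH hproj using h.2
  have hη2 : 4 * domainNorm {H | H.PosSemidef ∧ H ∈ K} X ^ 2 = 2 * η ^ 2 := by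
    rw [hηD, mul_pow, Real.sq_sqrt zero_le_two]; ring
  set g : Fin T → Fin d → ℝ := fun t => (gradient (ℓ t) (x t.castSucc)).ofLp with hg
  have hstep : ∀ t : Fin T, 2 * (g t ⬝ᵥ (x t.castSucc - z).ofLp) +
      (x t.succ - z).ofLp ⬝ᵥ (H t *ᵥ (x t.succ - z).ofLp) ≤
        (x t.castSucc - z).ofLp ⬝ᵥ (H t *ᵥ (x t.castSucc - z).ofLp) + g t ⬝ᵥ ((H t)⁻¹ *ᵥ g t) :=
    fun t => (hproj t).two_mul_dotProduct_le hX (hH t).1.2 hz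
  -- The invariant carries telescoping and be-the-leader together: `2η² Tr H_k` pays for the changes
  -- of norm, the rest is the objective at its minimizer.
  have hind : ∀ k (hk : k < T),
      ∑ t ∈ Finset.Iic (⟨k, hk⟩ : Fin T), 2 * (g t ⬝ᵥ (x t.castSucc - z).ofLp) +
        (x (Fin.succ ⟨k, hk⟩) - z).ofLp ⬝ᵥ (H ⟨k, hk⟩ *ᵥ (x (Fin.succ ⟨k, hk⟩) - z).ofLp) ≤
      2 * η ^ 2 * (H ⟨k, hk⟩).trace + (frobInner (gradGram ε ℓ x ⟨k, hk⟩) (H ⟨k, hk⟩)⁻¹ +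
        η ^ 2 * (H ⟨k, hk⟩).trace) := by
    intro k
    induction k with
    | zero =>
      intro hk
      have h1 := hstep ⟨0, hk⟩
      have h2 := quad_sub_le_trace_mul_domainNorm hXb (hH ⟨0, hk⟩).1.1.1 (hH ⟨0, hk⟩).1.1.2
        (hmem (Fin.castSucc ⟨0, hk⟩)) hz
      have h3 := (hH ⟨0, hk⟩).1.2.posSemidef.trace_nonneg
      have h4 := (hH ⟨0, hk⟩).1.2.inv.posSemidef.trace_nonneg
      rw [hη2] at h2
      rw [Fin.Iic_mk_zero, Finset.sum_singleton, gradGram, Fin.Iic_mk_zero, Finset.sum_singleton,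
        frobInner_add_left, frobInner_smul_left, frobInner_one_left, frobInner_vecMulVec]
      have h5 : 0 ≤ ε * (H ⟨0, hk⟩)⁻¹.trace := mul_nonneg hε.le h4
      have h6 : 0 ≤ η ^ 2 * (H ⟨0, hk⟩).trace := mul_nonneg (sq_nonneg _) h3
      linarith
    | succ k ih =>
      intro hk
      have ih := ih (by omega)
      have h1 := hstep ⟨k + 1, hk⟩
      have hmono : (H ⟨k + 1, hk⟩ - H ⟨k, by omega⟩).PosSemidef := by
        refine (hH ⟨k, by omega⟩).mono hη (posDef_gradGram hε _).isHermitian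
          (posDef_gradGram hε _).isHermitian (hH ⟨k + 1, hk⟩) ?_
        rw [gradGram_succ hk, add_sub_cancel_left]
        have := posSemidef_vecMulVec_self_star (g ⟨k + 1, hk⟩)
        rwa [star_trivial] at this
      have h2 := quad_sub_le_trace_mul_domainNorm hXb hmono
        (K.sub_mem (hH ⟨k + 1, hk⟩).1.1.2 (hH ⟨k, by omega⟩).1.1.2)
        (hmem (Fin.castSucc ⟨k + 1, hk⟩)) hz
      rw [hη2, sub_mulVec, dotProduct_sub, trace_sub] at h2
      -- Be-the-leader: replacing the minimizer for `k` by the next preconditioner can only increase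
      -- the old objective; the new gradient term then completes the new one.
      have h3 : frobInner (gradGram ε ℓ x ⟨k, by omega⟩) (H ⟨k, by omega⟩)⁻¹ +
          η ^ 2 * (H ⟨k, by omega⟩).trace ≤
          frobInner (gradGram ε ℓ x ⟨k, by omega⟩) (H ⟨k + 1, hk⟩)⁻¹ +
          η ^ 2 * (H ⟨k + 1, hk⟩).trace := (hH ⟨k, by omega⟩).2 (hH ⟨k + 1, hk⟩).1
      have e : (Fin.succ ⟨k, by omega⟩ : Fin (T + 1)) = Fin.castSucc ⟨k + 1, hk⟩ := rfl
      rw [e] at ih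
      rw [Fin.Iic_mk_succ hk, Finset.sum_insert (Fin.Iic_mk_succ_notMem hk), gradGram_succ hk,
        frobInner_add_left, frobInner_vecMulVec]
      linarith
  obtain ⟨n, rfl⟩ : ∃ n, T = n + 1 := ⟨T - 1, by omega⟩
  have hlast := hind n (by omega)
  have huniv : Finset.Iic (⟨n, by omega⟩ : Fin (n + 1)) = Finset.univ := by
    ext ⟨i, hi⟩
    simp only [Finset.mem_Iic, Fin.mk_le_mk, Finset.mem_univ, iff_true]
    omega
  -- Equality of the two summands makes `2η² Tr H` equal to the objective itself, so the right side
  -- of `hlast` is twice the minimum.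
  have hopt := (hH ⟨n, by omega⟩).frobInner_inv_eq
  have hq := PosSemidef.quad_nonneg (hH ⟨n, by omega⟩).1.2.posSemidef
    (x (Fin.succ ⟨n, by omega⟩) - z).ofLp
  have hcmp : frobInner (gradGram ε ℓ x ⟨n, by omega⟩) (H ⟨n, by omega⟩)⁻¹ +
      η ^ 2 * (H ⟨n, by omega⟩).trace ≤
      frobInner (gradGram ε ℓ x ⟨n, by omega⟩) H'⁻¹ + η ^ 2 * H'.trace :=
    (hH ⟨n, by omega⟩).2 ⟨⟨hH'.posSemidef, hK'⟩, hH'⟩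
  have hM : frobInner (gradGram ε ℓ x ⟨n, by omega⟩) H'⁻¹ =
      ε * H'⁻¹.trace + ∑ t : Fin (n + 1), g t ⬝ᵥ (H'⁻¹ *ᵥ g t) := by
    rw [gradGram, huniv, frobInner_add_left, frobInner_smul_left, frobInner_one_left,
      frobInner_sum_left]
    simp only [frobInner_vecMulVec, hg]
  rw [huniv, ← Finset.mul_sum] at hlast
  rw [hM] at hcmp
  linarith

/-- With `η = 0` the two equal summands would vanish, while `M ⪰ ε I` forces `⟨M, H⁻¹⟩ > 0`. Thus
attainment of the minima excludes a domain of norm zero. -/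
theorem IsRun.eta_ne_zero (hd : 0 < d) (hT : 0 < T) (hε : 0 < ε)
    (h : IsRun {H | H.PosSemidef ∧ H ∈ K} X ε η x₁ ℓ x) : η ≠ 0 := by
  rintro rfl
  obtain ⟨H, hH, -⟩ := h.2 ⟨0, hT⟩
  have h1 := hH.frobInner_inv_eq
  have : Nonempty (Fin d) := ⟨⟨0, hd⟩⟩
  have h2 : 0 < H⁻¹.trace := hH.1.2.inv.trace_pos
  rw [gradGram, frobInner_add_left, frobInner_smul_left, frobInner_one_left] at h1
  have h3 : 0 ≤ frobInner (∑ s ∈ Finset.Iic (⟨0, hT⟩ : Fin T),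
      vecMulVec (gradient (ℓ s) (x s.castSucc)).ofLp (gradient (ℓ s) (x s.castSucc)).ofLp) H⁻¹ :=
    frobInner_nonneg (posSemidef_sum _ fun s _ => by
      simpa using posSemidef_vecMulVec_self_star (gradient (ℓ s) (x s.castSucc)).ofLp)
      hH.1.2.inv.posSemidef
  nlinarith [mul_pos hε h2]

end Regret
-- Smoothness and the gradient.
section Smooth

variable {d : ℕ} {L : EuclideanSpace ℝ (Fin d) → ℝ}

theorem gradient_dotProduct (f : EuclideanSpace ℝ (Fin d) → ℝ) (x v : EuclideanSpace ℝ (Fin d)) :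
    (gradient f x).ofLp ⬝ᵥ v.ofLp = fderiv ℝ f x v := by
  rw [← InnerProductSpace.toDual_symm_apply (𝕜 := ℝ), EuclideanSpace.inner_eq_star_dotProduct,
    star_trivial, dotProduct_comm]
  rfl

theorem gradient_apply (f : EuclideanSpace ℝ (Fin d) → ℝ) (x : EuclideanSpace ℝ (Fin d))
    (i : Fin d) : gradient f x i = fderiv ℝ f x (EuclideanSpace.single i 1) := by
  rw [← gradient_dotProduct]
  simp

theorem quad_hessian (f : EuclideanSpace ℝ (Fin d) → ℝ) (x v : EuclideanSpace ℝ (Fin d)) :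
    v.ofLp ⬝ᵥ (hessian f x *ᵥ v.ofLp) = fderiv ℝ (fderiv ℝ f) x v v := by
  have hv : v = ∑ i, v i • EuclideanSpace.single i (1 : ℝ) := by
    ext j
    simp [Finset.sum_apply, Pi.single_apply]
  conv_rhs => rw [hv]
  simp only [map_sum, map_smul, _root_.sum_apply, _root_.smul_apply,
    dotProduct, mulVec, hessian, of_apply, smul_eq_mul, Finset.mul_sum]
  rw [Finset.sum_comm]
  exact Finset.sum_congr rfl fun i _ => Finset.sum_congr rfl fun j _ => by ring

/-- The descent lemma. -/
theorem le_add_quad_of_hessian_le (h1 : Differentiable ℝ L) (h2 : Differentiable ℝ (fderiv ℝ L))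
    {H : Matrix (Fin d) (Fin d) ℝ} (hH : ∀ x, LoewnerLE (hessian L x) H)
    (x v : EuclideanSpace ℝ (Fin d)) :
    L (x + v) ≤ L x + fderiv ℝ L x v + (v.ofLp ⬝ᵥ (H *ᵥ v.ofLp)) / 2 := by
  set c := v.ofLp ⬝ᵥ (H *ᵥ v.ofLp) with hc
  have hline : ∀ s : ℝ, HasDerivAt (fun s : ℝ => x + s • v) v s := fun s => by
    simpa using ((hasDerivAt_id s).smul_const v).const_add x
  have hφ : ∀ s : ℝ, HasDerivAt (fun s : ℝ => L (x + s • v)) (fderiv ℝ L (x + s • v) v) s :=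
    fun s => (h1 _).hasFDerivAt.comp_hasDerivAt s (hline s)
  have hφ' : ∀ s : ℝ, HasDerivAt (fun s : ℝ => fderiv ℝ L (x + s • v) v)
      (fderiv ℝ (fderiv ℝ L) (x + s • v) v v) s := fun s => by
    have := (h2 _).hasFDerivAt.comp_hasDerivAt s (hline s)
    exact (ContinuousLinearMap.apply ℝ ℝ v).hasFDerivAt.comp_hasDerivAt s this
  have hle : ∀ y, fderiv ℝ (fderiv ℝ L) y v v ≤ c := fun y => by
    have := PosSemidef.quad_nonneg (hH y) v.ofLp
    rw [sub_mulVec, dotProduct_sub, quad_hessian] at this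
    linarith
  -- `χ` is the derivative of the `ψ` below. The Hessian bound makes `χ` antitone with `χ 0 = 0`, so
  -- `ψ` decreases on `[0, 1]`; no continuity of the Hessian is used.
  set χ : ℝ → ℝ := fun s => fderiv ℝ L (x + s • v) v - fderiv ℝ L x v - s * c with hχ
  have hχd : ∀ s, HasDerivAt χ (fderiv ℝ (fderiv ℝ L) (x + s • v) v v - c) s := fun s => by
    have h := ((hφ' s).sub_const (fderiv ℝ L x v)).sub ((hasDerivAt_id s).mul_const c)
    rw [one_mul] at h
    exact h
  have hχa : Antitone χ := antitone_of_deriv_nonpos (fun s => (hχd s).differentiableAt)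
    fun s => by rw [(hχd s).deriv]; linarith [hle (x + s • v)]
  have hχ0 : ∀ s, 0 ≤ s → χ s ≤ 0 := fun s hs => by
    have := hχa hs
    simpa [hχ] using this
  set ψ : ℝ → ℝ := fun s => L (x + s • v) - s * fderiv ℝ L x v - s ^ 2 * (c / 2) with hψ
  have hψd : ∀ s, HasDerivAt ψ (χ s) s := fun s => by
    have := ((hφ s).sub ((hasDerivAt_id s).mul_const (fderiv ℝ L x v))).sub
      ((hasDerivAt_pow 2 s).mul_const (c / 2))
    have e : χ s = fderiv ℝ L (x + s • v) v - 1 * fderiv ℝ L x v -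
        ((2 : ℕ) : ℝ) * s ^ (2 - 1) * (c / 2) := by
      simp only [hχ]
      push_cast
      ring
    rw [e]
    exact this
  have hψa : AntitoneOn ψ (Set.Icc 0 1) := by
    refine antitoneOn_of_deriv_nonpos (convex_Icc 0 1)
      (fun s _ => (hψd s).continuousAt.continuousWithinAt)
      (fun s _ => (hψd s).differentiableAt.differentiableWithinAt) fun s hs => ?_
    rw [(hψd s).deriv]
    rw [interior_Icc] at hs
    exact hχ0 s hs.1.le
  have := hψa (Set.left_mem_Icc.2 zero_le_one) (Set.right_mem_Icc.2 zero_le_one) zero_le_one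
  simp [hψ] at this
  linarith

/-- The gradient of a function that is smooth and bounded below is controlled by its excess. -/
theorem gradient_quad_inv_le (h1 : Differentiable ℝ L) (h2 : Differentiable ℝ (fderiv ℝ L))
    {H : Matrix (Fin d) (Fin d) ℝ} (hHp : H.PosDef) (hH : ∀ x, LoewnerLE (hessian L x) H)
    {xs : EuclideanSpace ℝ (Fin d)} (hmin : ∀ y, L xs ≤ L y) (x : EuclideanSpace ℝ (Fin d)) :
    (gradient L x).ofLp ⬝ᵥ (H⁻¹ *ᵥ (gradient L x).ofLp) ≤ 2 * (L x - L xs) := by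
  set g := (gradient L x).ofLp with hg
  -- The step `-H⁻¹ g` minimizes the quadratic upper bound and lowers it by `gᵀ H⁻¹ g / 2`.
  have h := le_add_quad_of_hessian_le h1 h2 hH x (WithLp.toLp 2 (-(H⁻¹ *ᵥ g)))
  have h' := hmin (x + WithLp.toLp 2 (-(H⁻¹ *ᵥ g)))
  rw [← gradient_dotProduct, ← hg] at h
  simp only [mulVec_neg, PosDef.mulVec_inv hHp, dotProduct_neg, neg_dotProduct] at h
  rw [dotProduct_comm (H⁻¹ *ᵥ g) g] at h
  linarith

theorem continuous_gradient (h2 : Differentiable ℝ (fderiv ℝ L)) : Continuous (gradient L) :=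
  (InnerProductSpace.toDual ℝ (EuclideanSpace ℝ (Fin d))).symm.continuous.comp h2.continuous

end Smooth
-- Measurability of the algorithm's minimizers.
section Graph

open MeasureTheory

/-- A function whose graph over a measurable function lies in a Borel graph is measurable. -/
theorem measurable_of_mem_graph {Ω α β : Type*} [MeasurableSpace Ω]
    [MeasurableSpace α] [StandardBorelSpace α] [MeasurableSpace β] [StandardBorelSpace β]
    {G : Set (α × β)} (hG : MeasurableSet G)
    (huniq : ∀ a b b', (a, b) ∈ G → (a, b') ∈ G → b = b') {f : Ω → α} {h : Ω → β}
    (hf : Measurable f) (hmem : ∀ ω, (f ω, h ω) ∈ G) : Measurable h := by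
  have : StandardBorelSpace G := hG.standardBorel
  -- Lusin–Souslin: an injective measurable map between standard Borel spaces is a measurable
  -- embedding.
  have he : MeasurableEmbedding (fun p : G => p.1.1) := by
    refine Measurable.measurableEmbedding (measurable_fst.comp measurable_subtype_coe) ?_
    rintro ⟨⟨a, b⟩, hp⟩ ⟨⟨a', b'⟩, hp'⟩ (rfl : a = a')
    obtain rfl := huniq a b b' hp hp'
    rfl
  have hk : Measurable (fun ω => (⟨(f ω, h ω), hmem ω⟩ : G)) := he.measurable_comp_iff.1 hf
  exact measurable_snd.comp (measurable_subtype_coe.comp hk)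

end Graph

section MatrixMeasurable

variable {d : ℕ}

instance : MeasurableSpace (Matrix (Fin d) (Fin d) ℝ) :=
  inferInstanceAs (MeasurableSpace (Fin d → Fin d → ℝ))

instance : BorelSpace (Matrix (Fin d) (Fin d) ℝ) :=
  inferInstanceAs (BorelSpace (Fin d → Fin d → ℝ))

instance : PolishSpace (Matrix (Fin d) (Fin d) ℝ) :=
  inferInstanceAs (PolishSpace (Fin d → Fin d → ℝ))

theorem isClosed_posSemidef : IsClosed {H : Matrix (Fin d) (Fin d) ℝ | H.PosSemidef} := by
  have : {H : Matrix (Fin d) (Fin d) ℝ | H.PosSemidef} =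
      {H | Hᴴ = H} ∩ ⋂ v : Fin d → ℝ, {H | 0 ≤ v ⬝ᵥ (H *ᵥ v)} := by
    ext H
    simp only [posSemidef_iff_dotProduct_mulVec, Set.mem_inter_iff, Set.mem_iInter,
      Set.mem_ofPred_eq, star_trivial, IsHermitian]
  rw [this]
  refine (isClosed_eq (by fun_prop) (by fun_prop)).inter (isClosed_iInter fun v => ?_)
  exact isClosed_le continuous_const (by fun_prop)

theorem PosDef.iff_det_ne_zero {H : Matrix (Fin d) (Fin d) ℝ} (h : H.PosSemidef) :
    H.PosDef ↔ H.det ≠ 0 := by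
  rw [h.posDef_iff_isUnit, isUnit_iff_isUnit_det, isUnit_iff_ne_zero]

theorem measurableSet_posDef : MeasurableSet {H : Matrix (Fin d) (Fin d) ℝ | H.PosDef} := by
  have : {H : Matrix (Fin d) (Fin d) ℝ | H.PosDef} = {H | H.PosSemidef} ∩ {H | H.det ≠ 0} := by
    ext H
    exact ⟨fun h => ⟨h.posSemidef, (PosDef.iff_det_ne_zero h.posSemidef).1 h⟩,
      fun h => (PosDef.iff_det_ne_zero h.1).2 h.2⟩
  rw [this]
  exact isClosed_posSemidef.measurableSet.inter
    (isOpen_ne_fun (Continuous.matrix_det continuous_id) continuous_const).measurableSet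

theorem eq_of_posSemidef_sub {A B : Matrix (Fin d) (Fin d) ℝ} (h₁ : (A - B).PosSemidef)
    (h₂ : (B - A).PosSemidef) : A = B := by
  open scoped MatrixOrder in
  exact le_antisymm (Matrix.le_iff.2 h₂) (Matrix.le_iff.2 h₁)

end MatrixMeasurable

section Steps

variable {d : ℕ} {Ω : Type*} [MeasurableSpace Ω]

/-- The first-order conditions are closed conditions on the pair `(M, H)`. Two solutions for the
same `M` are comparable both ways by `posSemidef_sub_of_sq`, hence equal. -/
theorem measurable_preconditioner {K : Subalgebra ℝ (Matrix (Fin d) (Fin d) ℝ)} {η : ℝ}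
    (hη : η ≠ 0) {M H : Ω → Matrix (Fin d) (Fin d) ℝ} (hM : Measurable M)
    (hMh : ∀ ω, (M ω).IsHermitian)
    (h : ∀ ω, IsPreconditioner {H | H.PosSemidef ∧ H ∈ K} η (M ω) (H ω)) : Measurable H := by
  set G : Set (Matrix (Fin d) (Fin d) ℝ × Matrix (Fin d) (Fin d) ℝ) :=
    {p | p.2.PosDef} ∩ ({p | p.2 ∈ K} ∩ ⋂ B ∈ {B | B ∈ K ∧ B.PosSemidef},
      {p | (B * p.1).trace = η ^ 2 * (B * (p.2 * p.2)).trace}) with hG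
  have hGm : MeasurableSet G := by
    refine (measurable_snd measurableSet_posDef).inter (IsClosed.measurableSet ?_)
    refine IsClosed.inter ?_ (isClosed_biInter fun B _ => ?_)
    · exact (Submodule.closed_of_finiteDimensional (Subalgebra.toSubmodule K)).preimage
        continuous_snd
    · exact isClosed_eq (by fun_prop) (by fun_prop)
  refine measurable_of_mem_graph hGm ?_ hM (fun ω => ⟨(h ω).1.2, (h ω).1.1.2, ?_⟩)
  · have key : ∀ a b b' : Matrix (Fin d) (Fin d) ℝ, (a, b) ∈ G → (a, b') ∈ G →
        (b - b').PosSemidef := by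
      intro a b b' hb hb'
      refine posSemidef_sub_of_sq hb'.1 hb.1 hb'.2.1 hb.2.1 fun B hBK hB => ?_
      have e1 := Set.mem_iInter₂.1 hb.2.2 B ⟨hBK, hB⟩
      have e2 := Set.mem_iInter₂.1 hb'.2.2 B ⟨hBK, hB⟩
      simp only [Set.mem_ofPred_eq] at e1 e2
      have e3 : (B * (b * b)).trace = (B * (b' * b')).trace :=
        mul_left_cancel₀ (pow_ne_zero 2 hη) (e1.symm.trans e2)
      rw [mul_sub, trace_sub, e3, sub_self]
    intro a b b' hb hb'
    exact eq_of_posSemidef_sub (key a b b' hb hb') (key a b' b hb' hb)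
  · exact Set.mem_iInter₂.2 fun B hB => (h ω).frobInner_eq (hMh ω) hB.2.isHermitian hB.1

/-- `X` need not be Borel, so the graph uses `closure X` with the variational inequality; adding the
inequalities of two solutions shows that they agree. -/
theorem measurable_projection {X : Set (EuclideanSpace ℝ (Fin d))} (hX : Convex ℝ X)
    {H : Ω → Matrix (Fin d) (Fin d) ℝ} {u y : Ω → EuclideanSpace ℝ (Fin d)} (hH : Measurable H)
    (hHp : ∀ ω, (H ω).PosDef) (hu : Measurable u) (h : ∀ ω, IsProjection X (H ω) (u ω) (y ω)) :
    Measurable y := by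
  set G : Set ((EuclideanSpace ℝ (Fin d) × Matrix (Fin d) (Fin d) ℝ) ×
      EuclideanSpace ℝ (Fin d)) :=
    {p | p.1.2.PosDef} ∩ ({p | p.2 ∈ closure X} ∩ ⋂ z ∈ X,
      {p | (p.1.1 - p.2).ofLp ⬝ᵥ (p.1.2 *ᵥ (z - p.2).ofLp) ≤ 0}) with hG
  have hGm : MeasurableSet G := by
    refine ((measurable_snd.comp measurable_fst) measurableSet_posDef).inter
      (IsClosed.measurableSet ?_)
    refine IsClosed.inter (isClosed_closure.preimage continuous_snd)
      (isClosed_biInter fun z _ => ?_)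
    exact isClosed_le (by fun_prop) continuous_const
  refine measurable_of_mem_graph hGm ?_ (hu.prodMk hH)
    (fun ω => ⟨hHp ω, subset_closure (h ω).1, Set.mem_iInter₂.2 fun z hz =>
      (h ω).variational hX (hHp ω).posSemidef hz⟩)
  rintro ⟨a, A⟩ b b' ⟨hA, hb, hbi⟩ ⟨-, hb', hbi'⟩
  have key : ∀ c, (∀ z ∈ X, (a - c).ofLp ⬝ᵥ (A *ᵥ (z - c).ofLp) ≤ 0) → ∀ z ∈ closure X,
      (a - c).ofLp ⬝ᵥ (A *ᵥ (z - c).ofLp) ≤ 0 := by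
    intro c hc
    have hcl : IsClosed {z : EuclideanSpace ℝ (Fin d) |
        (a - c).ofLp ⬝ᵥ (A *ᵥ (z - c).ofLp) ≤ 0} := isClosed_le (by fun_prop) continuous_const
    exact fun z hz => hcl.closure_subset_iff.2 hc hz
  have h1 := key b (fun z hz => Set.mem_iInter₂.1 hbi z hz) b' hb'
  have h2 := key b' (fun z hz => Set.mem_iInter₂.1 hbi' z hz) b hb
  by_contra hne
  have hne' : (b - b').ofLp ≠ 0 := fun h0 => hne (sub_eq_zero.1 (by ext i; exact congrFun h0 i))
  have h3 := hA.dotProduct_mulVec_pos hne'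
  simp only [star_trivial, WithLp.ofLp_sub, mulVec_sub, dotProduct_sub, sub_dotProduct] at h1 h2 h3
  linarith

end Steps
-- Random differentiable functions.
section FunctionSpace

open Filter Topology

variable {d : ℕ}

/-- Differentiable functions, with the σ-algebra generated by the evaluations. -/
abbrev DiffFun (d : ℕ) := {f : EuclideanSpace ℝ (Fin d) → ℝ // Differentiable ℝ f}

/-- A Carathéodory function, continuous in the point and measurable in the function, is jointly
measurable. This allows losses to be evaluated at random points. -/
theorem measurable_diffFun_eval :
    Measurable fun p : DiffFun d × EuclideanSpace ℝ (Fin d) => p.1.1 p.2 := by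
  have h : Measurable (Function.uncurry
      fun (y : EuclideanSpace ℝ (Fin d)) (f : DiffFun d) => f.1 y) :=
    MeasureTheory.measurable_uncurry_of_continuous_of_measurable (fun f => f.2.continuous)
      fun y => (measurable_pi_apply y).comp measurable_subtype_coe
  exact h.comp measurable_swap

theorem measurable_diffFun_gradient :
    Measurable fun p : DiffFun d × EuclideanSpace ℝ (Fin d) => gradient p.1.1 p.2 := by
  have hcoord : ∀ i : Fin d,
      Measurable fun p : DiffFun d × EuclideanSpace ℝ (Fin d) => gradient p.1.1 p.2 i := by
    intro i
    set e : EuclideanSpace ℝ (Fin d) := EuclideanSpace.single i (1 : ℝ)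
    refine measurable_of_tendsto_metrizable (f := fun (n : ℕ)
      (p : DiffFun d × EuclideanSpace ℝ (Fin d)) =>
        (n : ℝ) • (p.1.1 (p.2 + (n : ℝ)⁻¹ • e) - p.1.1 p.2)) (fun n => ?_) ?_
    · refine Measurable.const_mul (Measurable.sub ?_ measurable_diffFun_eval) (n : ℝ)
      exact measurable_diffFun_eval.comp
        (measurable_fst.prodMk (measurable_snd.add_const ((n : ℝ)⁻¹ • e)))
    · refine tendsto_pi_nhds.2 fun p => ?_
      rw [gradient_apply]
      exact ((p.1.2 p.2).hasFDerivAt.lim_real e).comp tendsto_natCast_atTop_atTop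
  exact (WithLp.measurable_toLp 2 _).comp (measurable_pi_lambda _ hcoord)

/-- The gradient inequality for convex functions. -/
theorem ConvexOn.sub_le_gradient_dotProduct {f : EuclideanSpace ℝ (Fin d) → ℝ}
    (hf : ConvexOn ℝ Set.univ f) (hd : Differentiable ℝ f) (y z : EuclideanSpace ℝ (Fin d)) :
    f y - f z ≤ (gradient f y).ofLp ⬝ᵥ (y - z).ofLp := by
  have h := (hd y).hasFDerivAt.lim_real (z - y)
  have hle : fderiv ℝ f y (z - y) ≤ f z - f y := by
    refine le_of_tendsto h ?_
    filter_upwards [eventually_ge_atTop (1 : ℝ)] with c hc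
    have hc0 : 0 < c := by linarith
    have h1 := hf.2 (Set.mem_univ y) (Set.mem_univ z)
      (show 0 ≤ 1 - c⁻¹ by linarith [inv_le_one_of_one_le₀ hc])
      (show 0 ≤ c⁻¹ by positivity) (by ring)
    have e : (1 - c⁻¹) • y + c⁻¹ • z = y + c⁻¹ • (z - y) := by module
    rw [e, smul_eq_mul, smul_eq_mul] at h1
    calc c • (f (y + c⁻¹ • (z - y)) - f y) ≤ c * (c⁻¹ * (f z - f y)) := by
          rw [smul_eq_mul]
          exact mul_le_mul_of_nonneg_left (by linarith) hc0.le
      _ = f z - f y := by field_simp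
  have e : fderiv ℝ f y (y - z) = - fderiv ℝ f y (z - y) := by rw [← map_neg, neg_sub]
  rw [gradient_dotProduct, e]
  linarith

end FunctionSpace

/-! ### Measurability and independence of the iterates. -/

section Iterates

variable {d T : ℕ} {K : Subalgebra ℝ (Matrix (Fin d) (Fin d) ℝ)}
  {X : Set (EuclideanSpace ℝ (Fin d))} {ε η : ℝ} {x₁ : EuclideanSpace ℝ (Fin d)}

/-- The iterate at time `t` is measurable with respect to the losses before `t`. -/
theorem IsRun.measurable_iterate {Ω : Type*} [MeasurableSpace Ω] (hX : Convex ℝ X) (hε : 0 < ε)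
    (hη : η ≠ 0) {ℓ : Fin T → Ω → DiffFun d} {x : Fin (T + 1) → Ω → EuclideanSpace ℝ (Fin d)}
    (hx : ∀ ω, IsRun {H | H.PosSemidef ∧ H ∈ K} X ε η x₁ (fun t => (ℓ t ω).1) (fun t => x t ω))
    (t : Fin (T + 1)) (hℓ : ∀ s : Fin T, s.castSucc < t → Measurable (ℓ s)) :
    Measurable (x t) := by
  have key : ∀ k (hk : k < T + 1), (⟨k, hk⟩ : Fin (T + 1)) ≤ t → Measurable (x ⟨k, hk⟩) := by
    intro k
    induction k using Nat.strong_induction_on with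
    | _ k ih =>
      intro hk hkt
      rcases k with _ | k
      · have : x ⟨0, hk⟩ = fun _ => x₁ := funext fun ω => (hx ω).1
        rw [this]
        exact measurable_const
      · set r : Fin T := ⟨k, by omega⟩ with hr
        have hlt : ∀ s : Fin T, s ≤ r → s.castSucc < t := fun s hs => by
          rw [Fin.lt_def]
          rw [Fin.le_def] at hs hkt
          simp only [Fin.val_castSucc, hr] at hs hkt ⊢
          omega
        have hxm : ∀ s : Fin T, s ≤ r → Measurable (x s.castSucc) := fun s hs => by
          rw [Fin.le_def] at hs
          simp only [hr] at hs
          exact ih s.val (by omega) _ (hlt s (Fin.le_def.2 hs)).le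
        have hg : ∀ s : Fin T, s ≤ r →
            Measurable fun ω => gradient (ℓ s ω).1 (x s.castSucc ω) := fun s hs =>
          measurable_diffFun_gradient.comp ((hℓ s (hlt s hs)).prodMk (hxm s hs))
        have hgi : ∀ s : Fin T, s ≤ r → ∀ i,
            Measurable fun ω => gradient (ℓ s ω).1 (x s.castSucc ω) i := fun s hs i =>
          (measurable_pi_apply i).comp ((WithLp.measurable_ofLp 2 _).comp (hg s hs))
        have hM : Measurable fun ω => gradGram ε (fun t => (ℓ t ω).1) (fun t => x t ω) r := by
          refine measurable_pi_lambda _ fun i => measurable_pi_lambda _ fun j => ?_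
          simp only [gradGram, Matrix.add_apply, Matrix.sum_apply, vecMulVec_apply]
          refine measurable_const.add (Finset.measurable_sum _ fun s hs => ?_)
          exact (hgi s (Finset.mem_Iic.1 hs) i).mul (hgi s (Finset.mem_Iic.1 hs) j)
        choose H hH hp using fun ω => (hx ω).2 r
        have hHm : Measurable H := measurable_preconditioner hη hM
          (fun ω => (posDef_gradGram hε r).isHermitian) hH
        refine measurable_projection hX hHm (fun ω => (hH ω).1.2) ?_ hp
        refine (hxm r le_rfl).sub ((WithLp.measurable_toLp 2 _).comp ?_)
        refine measurable_pi_lambda _ fun i => ?_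
        have hinv : Measurable fun A : Matrix (Fin d) (Fin d) ℝ => A⁻¹ := by
          have : (fun A : Matrix (Fin d) (Fin d) ℝ => A⁻¹) =
              fun A => (A.det)⁻¹ • A.adjugate := by
            ext A
            rw [inv_def, Ring.inverse_eq_inv']
          rw [this]
          have hdet : Measurable fun A : Matrix (Fin d) (Fin d) ℝ => A.det :=
            (Continuous.matrix_det continuous_id).measurable
          have hadj : Measurable fun A : Matrix (Fin d) (Fin d) ℝ => A.adjugate :=
            (Continuous.matrix_adjugate continuous_id).measurable
          exact hdet.inv.smul hadj
        simp only [mulVec, dotProduct]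
        refine Finset.measurable_sum _ fun j _ => Measurable.mul ?_ (hgi r le_rfl j)
        exact (measurable_pi_apply j).comp ((measurable_pi_apply i).comp (hinv.comp hHm))
  exact key t.val t.isLt le_rfl

open MeasureTheory ProbabilityTheory

theorem IsRun.indepFun_iterate {Ω : Type*} [MeasurableSpace Ω] {μ : Measure Ω}
    [IsProbabilityMeasure μ] (hX : Convex ℝ X) (hε : 0 < ε)
    (hη : η ≠ 0) {ℓ : Fin T → Ω → DiffFun d} (hmeas : ∀ t, Measurable (ℓ t))
    (hindep : iIndepFun (fun t ω => (ℓ t ω).1) μ)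
    {x : Fin (T + 1) → Ω → EuclideanSpace ℝ (Fin d)}
    (hx : ∀ ω, IsRun {H | H.PosSemidef ∧ H ∈ K} X ε η x₁ (fun t => (ℓ t ω).1) (fun t => x t ω))
    (t : Fin T) : IndepFun (ℓ t) (x t.castSucc) μ := by
  set m : Fin T → MeasurableSpace Ω := fun s => MeasurableSpace.comap (ℓ s) inferInstance with hm
  have hcomap : ∀ s, m s = MeasurableSpace.comap (fun ω => (ℓ s ω).1) inferInstance := fun s =>
    MeasurableSpace.comap_comp
  have hi : iIndep m μ := by
    rw [iIndepFun_iff_iIndep] at hindep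
    simp only [← hcomap] at hindep
    exact hindep
  have h := indep_iSup_of_disjoint (fun s => (hmeas s).comap_le) hi
    (S := {t}) (T := {s | s < t}) (by simp)
  rw [IndepFun_iff_Indep]
  refine indep_of_indep_of_le_left (indep_of_indep_of_le_right h ?_) (by simp)
  refine Measurable.comap_le (m₁ := ⨆ s ∈ {s | s < t}, m s) ?_
  -- Measurability is applied with `Ω` carrying only the σ-algebra generated by the losses before
  -- `t`.
  refine @IsRun.measurable_iterate d T K X ε η x₁ Ω (⨆ s ∈ {s | s < t}, m s) hX hε hη ℓ x hx
    t.castSucc fun s hs => ?_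
  refine measurable_iff_comap_le.2 ?_
  exact le_iSup₂ (f := fun s (_ : s ∈ {s | s < t}) => m s) s (by simpa using hs)

end Iterates

/-! ### Freezing an independent variable. -/

section Freezing

open MeasureTheory ProbabilityTheory

variable {Ω α β : Type*} [MeasurableSpace Ω] [MeasurableSpace α] [MeasurableSpace β]
  {μ : Measure Ω} [IsProbabilityMeasure μ] {U : Ω → α} {V : Ω → β}

/-- Tonelli on the product law. No integrability is assumed, so this bound can supply it for the
noise. -/
theorem lintegral_le_of_indepFun (hU : Measurable U) (hV : Measurable V) (h : IndepFun U V μ)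
    {F : α × β → ENNReal} (hF : Measurable F) {c : ENNReal}
    (hc : ∀ ω, ∫⁻ ω', F (U ω', V ω) ∂μ ≤ c) : ∫⁻ ω, F (U ω, V ω) ∂μ ≤ c := by
  have e := (indepFun_iff_map_prod_eq_prod_map_map hU.aemeasurable hV.aemeasurable).1 h
  calc ∫⁻ ω, F (U ω, V ω) ∂μ = ∫⁻ p, F p ∂((μ.map U).prod (μ.map V)) := by
        rw [← e, lintegral_map hF (hU.prodMk hV)]
    _ = ∫⁻ ω, ∫⁻ ω', F (U ω', V ω) ∂μ ∂μ := by
        rw [lintegral_prod_symm' _ hF, lintegral_map hF.lintegral_prod_left' hV]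
        refine lintegral_congr fun ω => ?_
        exact lintegral_map (hF.comp measurable_prodMk_right) hU
    _ ≤ ∫⁻ _, c ∂μ := lintegral_mono hc
    _ = c := by simp

theorem integral_le_of_indepFun (hU : Measurable U) (hV : Measurable V) (h : IndepFun U V μ)
    {F : α × β → ℝ} (hF : Measurable F) (hFi : Integrable (fun ω => F (U ω, V ω)) μ) {G : Ω → ℝ}
    (hG : Integrable G μ) (hc : ∀ ω, G ω ≤ ∫ ω', F (U ω', V ω) ∂μ) :
    ∫ ω, G ω ∂μ ≤ ∫ ω, F (U ω, V ω) ∂μ := by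
  have e := (indepFun_iff_map_prod_eq_prod_map_map hU.aemeasurable hV.aemeasurable).1 h
  have hi : Integrable F ((μ.map U).prod (μ.map V)) := by
    rw [← e, integrable_map_measure hF.aestronglyMeasurable (hU.prodMk hV).aemeasurable]
    exact hFi
  have hP : IsProbabilityMeasure (μ.map U) := Measure.isProbabilityMeasure_map hU.aemeasurable
  have hin : ∀ ω, ∫ a, F (a, V ω) ∂(μ.map U) = ∫ ω', F (U ω', V ω) ∂μ := fun ω =>
    integral_map hU.aemeasurable (hF.comp measurable_prodMk_right).aestronglyMeasurable
  have hi2 := hi.integral_prod_right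
  have e2 : ∫ ω, F (U ω, V ω) ∂μ = ∫ ω, ∫ ω', F (U ω', V ω) ∂μ ∂μ := by
    rw [← integral_map (φ := fun ω => (U ω, V ω)) (hU.prodMk hV).aemeasurable
      hF.aestronglyMeasurable, e, integral_prod_symm _ hi,
      integral_map hV.aemeasurable hi2.aestronglyMeasurable]
    simp only [hin]
  rw [e2]
  refine integral_mono hG ?_ hc
  have := (integrable_map_measure hi2.aestronglyMeasurable hV.aemeasurable).1 hi2
  simpa only [Function.comp_def, hin] using this

end Freezing
-- Expectations of the noise and of the excess.
section Noise

open MeasureTheory ProbabilityTheory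

variable {d : ℕ} {Ω : Type*} [MeasurableSpace Ω] {μ : Measure Ω}
  {X : Set (EuclideanSpace ℝ (Fin d))} {L : EuclideanSpace ℝ (Fin d) → ℝ}
  {S : Matrix (Fin d) (Fin d) ℝ}

/-- The noise in a dual norm has finite expectation, bounded through the covariance bound. -/
theorem NoiseBounded.integral_quad_le {f : Ω → EuclideanSpace ℝ (Fin d) → ℝ}
    (h : NoiseBounded μ X L S f) {N : Matrix (Fin d) (Fin d) ℝ} (hN : N.PosSemidef)
    {y : EuclideanSpace ℝ (Fin d)} (hy : y ∈ X) :
    Integrable (fun ω => (gradient (f ω) y - gradient L y).ofLp ⬝ᵥ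
        (N *ᵥ (gradient (f ω) y - gradient L y).ofLp)) μ ∧
      ∫ ω, (gradient (f ω) y - gradient L y).ofLp ⬝ᵥ
        (N *ᵥ (gradient (f ω) y - gradient L y).ofLp) ∂μ ≤ frobInner S N := by
  obtain ⟨-, -, hint, hle⟩ := h y hy
  have e : ∀ ω, (gradient (f ω) y - gradient L y).ofLp ⬝ᵥ
      (N *ᵥ (gradient (f ω) y - gradient L y).ofLp) =
      ∑ i, ∑ j, N i j * ((gradient (f ω) y - gradient L y) i *
        (gradient (f ω) y - gradient L y) j) := by
    intro ω
    simp only [dotProduct, mulVec, Finset.mul_sum]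
    exact Finset.sum_congr rfl fun i _ => Finset.sum_congr rfl fun j _ => by ring
  have hi : ∀ i j, Integrable (fun ω => N i j * ((gradient (f ω) y - gradient L y) i *
      (gradient (f ω) y - gradient L y) j)) μ := fun i j => (hint i j).const_mul _
  simp only [e]
  refine ⟨integrable_finsetSum _ fun i _ => integrable_finsetSum _ fun j _ => hi i j, ?_⟩
  rw [integral_finsetSum _ fun i _ => integrable_finsetSum _ fun j _ => hi i j]
  have hp := frobInner_nonneg hle hN
  set C : Matrix (Fin d) (Fin d) ℝ := Matrix.of fun i j => ∫ ω,
      (gradient (f ω) y - gradient L y) i * (gradient (f ω) y - gradient L y) j ∂μ with hC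
  have hsum : ∑ i, ∫ ω, ∑ j, N i j * ((gradient (f ω) y - gradient L y) i *
      (gradient (f ω) y - gradient L y) j) ∂μ = frobInner C N := by
    simp only [frobInner, trace, diag_apply, mul_apply, transpose_apply]
    rw [Finset.sum_comm]
    refine Finset.sum_congr rfl fun i _ => ?_
    rw [integral_finsetSum _ fun j _ => hi i j]
    refine Finset.sum_congr rfl fun j _ => ?_
    rw [integral_const_mul, mul_comm]
    rfl
  rw [hsum]
  simp only [frobInner, transpose_sub, sub_mul, trace_sub] at hp ⊢
  linarith

theorem measurable_noise_quad (hL : Continuous (gradient L)) (N : Matrix (Fin d) (Fin d) ℝ) :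
    Measurable fun p : DiffFun d × EuclideanSpace ℝ (Fin d) =>
      (gradient p.1.1 p.2 - gradient L p.2).ofLp ⬝ᵥ
        (N *ᵥ (gradient p.1.1 p.2 - gradient L p.2).ofLp) := by
  have h1 : Measurable fun p : DiffFun d × EuclideanSpace ℝ (Fin d) =>
      gradient p.1.1 p.2 - gradient L p.2 :=
    measurable_diffFun_gradient.sub (hL.measurable.comp measurable_snd)
  have h2 : Continuous fun v : EuclideanSpace ℝ (Fin d) => v.ofLp ⬝ᵥ (N *ᵥ v.ofLp) := by fun_prop
  exact h2.measurable.comp h1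

theorem NoiseBounded.integral_quad_le_of_indepFun [IsProbabilityMeasure μ] {U : Ω → DiffFun d}
    {V : Ω → EuclideanSpace ℝ (Fin d)} (hU : Measurable U) (hV : Measurable V)
    (hUV : IndepFun U V μ) (hVX : ∀ ω, V ω ∈ X) (h : NoiseBounded μ X L S fun ω => (U ω).1)
    (hS : S.PosSemidef) (hL : Continuous (gradient L)) {N : Matrix (Fin d) (Fin d) ℝ}
    (hN : N.PosSemidef) :
    Integrable (fun ω => (gradient (U ω).1 (V ω) - gradient L (V ω)).ofLp ⬝ᵥ
        (N *ᵥ (gradient (U ω).1 (V ω) - gradient L (V ω)).ofLp)) μ ∧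
      ∫ ω, (gradient (U ω).1 (V ω) - gradient L (V ω)).ofLp ⬝ᵥ
        (N *ᵥ (gradient (U ω).1 (V ω) - gradient L (V ω)).ofLp) ∂μ ≤ frobInner S N := by
  have hF := measurable_noise_quad hL N
  have hm := hF.comp (hU.prodMk hV)
  have hnn : ∀ ω, 0 ≤ (gradient (U ω).1 (V ω) - gradient L (V ω)).ofLp ⬝ᵥ
        (N *ᵥ (gradient (U ω).1 (V ω) - gradient L (V ω)).ofLp) := fun ω =>
    PosSemidef.quad_nonneg hN _
  have hle := lintegral_le_of_indepFun hU hV hUV hF.ennreal_ofReal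
    (c := ENNReal.ofReal (frobInner S N)) fun ω => by
      obtain ⟨h1, h2⟩ := h.integral_quad_le hN (hVX ω)
      rw [← ofReal_integral_eq_lintegral_ofReal h1
        (Filter.Eventually.of_forall fun ω' => PosSemidef.quad_nonneg hN _)]
      exact ENNReal.ofReal_le_ofReal h2
  have hi : Integrable (fun ω => (gradient (U ω).1 (V ω) - gradient L (V ω)).ofLp ⬝ᵥ
        (N *ᵥ (gradient (U ω).1 (V ω) - gradient L (V ω)).ofLp)) μ := by
    refine ⟨hm.aestronglyMeasurable, ?_⟩
    rw [hasFiniteIntegral_iff_ofReal (Filter.Eventually.of_forall hnn)]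
    exact hle.trans_lt ENNReal.ofReal_lt_top
  refine ⟨hi, ?_⟩
  rw [← ofReal_integral_eq_lintegral_ofReal hi (Filter.Eventually.of_forall hnn)] at hle
  exact (ENNReal.ofReal_le_ofReal_iff (frobInner_nonneg hS hN)).1 hle

theorem integrable_comp_of_bounded [IsFiniteMeasure μ] {f : EuclideanSpace ℝ (Fin d) → ℝ} (hf : Continuous f)
    (hX : Bornology.IsBounded X) {V : Ω → EuclideanSpace ℝ (Fin d)} (hV : Measurable V)
    (hVX : ∀ ω, V ω ∈ X) : Integrable (fun ω => f (V ω)) μ := by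
  obtain ⟨C, hC⟩ := hX.isCompact_closure.exists_bound_of_continuousOn hf.continuousOn
  exact Integrable.of_bound (hf.measurable.comp hV).aestronglyMeasurable C
    (Filter.Eventually.of_forall fun ω => hC _ (subset_closure (hVX ω)))

/-- The inner product of a stochastic gradient with a bounded direction is integrable, and its
expectation bounds the expected excess. -/
theorem NoiseBounded.integral_excess_le [IsProbabilityMeasure μ] {U : Ω → DiffFun d}
    {V : Ω → EuclideanSpace ℝ (Fin d)} (hU : Measurable U) (hV : Measurable V)
    (hUV : IndepFun U V μ) (hX : Bornology.IsBounded X) (hVX : ∀ ω, V ω ∈ X)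
    (h : NoiseBounded μ X L S fun ω => (U ω).1)
    (hS : S.PosSemidef) (hLd : Differentiable ℝ L) (hL : Continuous (gradient L))
    (hconv : ∀ ω, ConvexOn ℝ Set.univ (U ω).1) {xs : EuclideanSpace ℝ (Fin d)} (hxs : xs ∈ X) :
    Integrable (fun ω => (gradient (U ω).1 (V ω)).ofLp ⬝ᵥ (V ω - xs).ofLp) μ ∧
      ∫ ω, (L (V ω) - L xs) ∂μ ≤
        ∫ ω, (gradient (U ω).1 (V ω)).ofLp ⬝ᵥ (V ω - xs).ofLp ∂μ := by
  have hF : Measurable fun p : DiffFun d × EuclideanSpace ℝ (Fin d) =>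
      (gradient p.1.1 p.2).ofLp ⬝ᵥ (p.2 - xs).ofLp := by
    have h2 : Continuous fun p : EuclideanSpace ℝ (Fin d) × EuclideanSpace ℝ (Fin d) =>
      p.1.ofLp ⬝ᵥ p.2.ofLp := by fun_prop
    exact h2.measurable.comp (measurable_diffFun_gradient.prodMk (measurable_snd.sub_const xs))
  -- A general `W` covers both the random iterate and the constant points needed in `hfix`.
  have hint : ∀ W : Ω → EuclideanSpace ℝ (Fin d), Measurable W → IndepFun U W μ →
      (∀ ω, W ω ∈ X) →
      Integrable (fun ω => (gradient (U ω).1 (W ω)).ofLp ⬝ᵥ (W ω - xs).ofLp) μ := by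
    intro W hW hUW hWX
    obtain ⟨hq, -⟩ := NoiseBounded.integral_quad_le_of_indepFun hU hW hUW hWX h hS hL PosSemidef.one
    have hb : Integrable (fun ω => (gradient L (W ω)).ofLp ⬝ᵥ (W ω - xs).ofLp) μ :=
      integrable_comp_of_bounded (f := fun y => (gradient L y).ofLp ⬝ᵥ (y - xs).ofLp)
        (by fun_prop) hX hW hWX
    have hb2 : Integrable (fun ω => (W ω - xs).ofLp ⬝ᵥ (W ω - xs).ofLp) μ :=
      integrable_comp_of_bounded (f := fun y => (y - xs).ofLp ⬝ᵥ (y - xs).ofLp)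
        (by fun_prop) hX hW hWX
    have hn : Integrable (fun ω => (gradient (U ω).1 (W ω)).ofLp ⬝ᵥ (W ω - xs).ofLp -
        (gradient L (W ω)).ofLp ⬝ᵥ (W ω - xs).ofLp) μ := by
      refine Integrable.mono' (hq.add hb2)
        ((hF.comp (hU.prodMk hW)).aestronglyMeasurable.sub hb.aestronglyMeasurable)
        (Filter.Eventually.of_forall fun ω => ?_)
      set n := (gradient (U ω).1 (W ω) - gradient L (W ω)).ofLp with hn
      set v := (W ω - xs).ofLp
      have e : (gradient (U ω).1 (W ω)).ofLp ⬝ᵥ v - (gradient L (W ω)).ofLp ⬝ᵥ v = n ⬝ᵥ v := by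
        rw [hn, WithLp.ofLp_sub, sub_dotProduct]
      have p1 : 0 ≤ (n - v) ⬝ᵥ (n - v) := by simpa using dotProduct_star_self_nonneg (n - v)
      have p2 : 0 ≤ (n + v) ⬝ᵥ (n + v) := by simpa using dotProduct_star_self_nonneg (n + v)
      have p3 : 0 ≤ n ⬝ᵥ n := by simpa using dotProduct_star_self_nonneg n
      have p4 : 0 ≤ v ⬝ᵥ v := by simpa using dotProduct_star_self_nonneg v
      simp only [dotProduct_sub, sub_dotProduct, dotProduct_add, add_dotProduct,
        dotProduct_comm v n] at p1 p2
      rw [e, Real.norm_eq_abs, abs_le, Pi.add_apply, one_mulVec]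
      constructor <;> linarith
    exact (hn.add hb).congr (Filter.Eventually.of_forall fun ω => by simp)
  have hfix : ∀ y ∈ X, Integrable (fun ω => (gradient (U ω).1 y).ofLp ⬝ᵥ (y - xs).ofLp) μ :=
    fun y hy => hint (fun _ => y) measurable_const (indepFun_const_right U y) fun _ => hy
  refine ⟨hint V hV hUV hVX, ?_⟩
  refine integral_le_of_indepFun hU hV hUV hF (hint V hV hUV hVX) (G := fun ω => L (V ω) - L xs)
    ((integrable_comp_of_bounded hLd.continuous hX hV hVX).sub (integrable_const _)) fun ω => ?_
  obtain ⟨i1, e1, -⟩ := h (V ω) (hVX ω)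
  obtain ⟨i2, e2, -⟩ := h xs hxs
  rw [← e1, ← e2, ← integral_sub i1 i2]
  -- The gradient inequality is applied to each random loss, whose values have mean `L`;
  -- unbiasedness of the gradients is never needed.
  exact integral_mono (i1.sub i2) (hfix _ (hVX ω)) fun ω' =>
    ConvexOn.sub_le_gradient_dotProduct (hconv ω') (U ω').2 _ _

theorem NoiseBounded.convexOn {f : Ω → EuclideanSpace ℝ (Fin d) → ℝ}
    (h : NoiseBounded μ X L S f) (hX : Convex ℝ X) (hconv : ∀ ω, ConvexOn ℝ Set.univ (f ω)) :
    ConvexOn ℝ X L := by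
  refine ⟨hX, fun y hy z hz a b ha hb hab => ?_⟩
  obtain ⟨i1, e1, -⟩ := h y hy
  obtain ⟨i2, e2, -⟩ := h z hz
  obtain ⟨i3, e3, -⟩ := h _ (hX hy hz ha hb hab)
  rw [← e1, ← e2, ← e3, smul_eq_mul, smul_eq_mul, ← integral_const_mul, ← integral_const_mul,
    ← integral_add (i1.const_mul _) (i2.const_mul _)]
  exact integral_mono i3 ((i1.const_mul _).add (i2.const_mul _)) fun ω =>
    (hconv ω).2 (Set.mem_univ _) (Set.mem_univ _) ha hb hab

end Noise

/-! ### The comparison preconditioner. -/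

section Combine

variable {d T : ℕ} {K : Subalgebra ℝ (Matrix (Fin d) (Fin d) ℝ)}
  {X : Set (EuclideanSpace ℝ (Fin d))} {ε η : ℝ} {x₁ : EuclideanSpace ℝ (Fin d)}

theorem trace_inv_le {A B : Matrix (Fin d) (Fin d) ℝ} (hA : A.PosSemidef) (hB : B.PosDef) {c : ℝ}
    (hc : 0 < c) : ((A + c • (1 : Matrix (Fin d) (Fin d) ℝ) + B)⁻¹).trace ≤ d / c := by
  have h : ∀ i : Fin d, (A + c • (1 : Matrix (Fin d) (Fin d) ℝ) + B)⁻¹ i i ≤ c⁻¹ := by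
    intro i
    have := quad_inv_add_le hA (PosDef.one.smul hc) hB (Pi.single i 1) 0
    simpa [inv_smul_of_posDef hc.ne' PosDef.one] using this
  calc ((A + c • (1 : Matrix (Fin d) (Fin d) ℝ) + B)⁻¹).trace ≤ ∑ _i : Fin d, c⁻¹ :=
        Finset.sum_le_sum fun i _ => h i
    _ = d / c := by simp [div_eq_mul_inv]

/-- The regret in terms of the noise and of the excess of a smooth function. -/
theorem IsRun.regret_le_noise {ℓ : Fin T → EuclideanSpace ℝ (Fin d) → ℝ}
    {x : Fin (T + 1) → EuclideanSpace ℝ (Fin d)}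
    (hT : 0 < T) (hX : Convex ℝ X) (hXb : Bornology.IsBounded X)
    (hε : 0 < ε) (hη : 0 < η) (hηD : η = √2 * domainNorm {H | H.PosSemidef ∧ H ∈ K} X)
    (hx₁ : x₁ ∈ X) (h : IsRun {H | H.PosSemidef ∧ H ∈ K} X ε η x₁ ℓ x)
    {L : EuclideanSpace ℝ (Fin d) → ℝ} (h1 : Differentiable ℝ L)
    (h2 : Differentiable ℝ (fderiv ℝ L)) {xs : EuclideanSpace ℝ (Fin d)} (hxs : xs ∈ X)
    (hmin : ∀ y, L xs ≤ L y) {H₂ H₃ : Matrix (Fin d) (Fin d) ℝ}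
    (hH₂ : H₂.PosDef) (hK₂ : H₂ ∈ K) (htr : H₂.trace ≤ 1) (hH₃ : H₃.PosDef) (hK₃ : H₃ ∈ K)
    (hhess : ∀ x, LoewnerLE (hessian L x) H₃) {c₁ c₂ : ℝ} (hc₁ : 0 < c₁) (hc₂ : 0 < c₂) :
    ∑ t : Fin T, (gradient (ℓ t) (x t.castSucc)).ofLp ⬝ᵥ (x t.castSucc - xs).ofLp ≤
      ε * (d / c₁) + η ^ 2 * (c₁ * d) + η ^ 2 * c₂ + 4 * η ^ 2 * H₃.trace +
      c₂⁻¹ * ∑ t : Fin T, (gradient (ℓ t) (x t.castSucc) - gradient L (x t.castSucc)).ofLp ⬝ᵥ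
        (H₂⁻¹ *ᵥ (gradient (ℓ t) (x t.castSucc) - gradient L (x t.castSucc)).ofLp) +
      (∑ t : Fin T, (L (x t.castSucc) - L xs)) / 2 := by
  set A : Matrix (Fin d) (Fin d) ℝ := c₁ • 1 with hA
  have hAp : A.PosDef := PosDef.one.smul hc₁
  have hBp : (c₂ • H₂).PosDef := hH₂.smul hc₂
  have hCp : ((4 : ℝ) • H₃).PosDef := hH₃.smul (by norm_num)
  -- `c₁ I` controls the trace of the inverse, `c₂ H₂` the noise and `4 H₃` the gradient of `L`. The
  -- factor `4` turns the bound `2 (L - L xs)` into half of the excess.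
  have hreg := h.regret_le hT hX hXb hε hη hηD hx₁ hxs
    ((hAp.add hBp).add hCp) (K.add_mem (K.add_mem (K.smul_mem K.one_mem _) (K.smul_mem hK₂ _))
      (K.smul_mem hK₃ _))
  have htrace : ((A + c₂ • H₂ + (4 : ℝ) • H₃)⁻¹).trace ≤ d / c₁ := by
    rw [add_comm A]
    exact trace_inv_le hBp.posSemidef hCp hc₁
  have hquad : ∀ t : Fin T, (gradient (ℓ t) (x t.castSucc)).ofLp ⬝ᵥ
      ((A + c₂ • H₂ + (4 : ℝ) • H₃)⁻¹ *ᵥ (gradient (ℓ t) (x t.castSucc)).ofLp) ≤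
      c₂⁻¹ * ((gradient (ℓ t) (x t.castSucc) - gradient L (x t.castSucc)).ofLp ⬝ᵥ
        (H₂⁻¹ *ᵥ (gradient (ℓ t) (x t.castSucc) - gradient L (x t.castSucc)).ofLp)) +
      (L (x t.castSucc) - L xs) / 2 := by
    intro t
    have q := quad_inv_add_le hAp.posSemidef hBp hCp
      (gradient (ℓ t) (x t.castSucc) - gradient L (x t.castSucc)).ofLp
      (gradient L (x t.castSucc)).ofLp
    rw [← WithLp.ofLp_add, sub_add_cancel, inv_smul_of_posDef hc₂.ne' hH₂,
      inv_smul_of_posDef (by norm_num) hH₃, smul_mulVec, smul_mulVec, dotProduct_smul,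
      dotProduct_smul, smul_eq_mul, smul_eq_mul] at q
    have r := gradient_quad_inv_le h1 h2 hH₃ hhess hmin (x t.castSucc)
    linarith
  have hsum := Finset.sum_le_sum fun (t : Fin T) (_ : t ∈ Finset.univ) => hquad t
  rw [Finset.sum_add_distrib, ← Finset.mul_sum, ← Finset.sum_div] at hsum
  have e : (A + c₂ • H₂ + (4 : ℝ) • H₃).trace = c₁ * d + c₂ * H₂.trace + 4 * H₃.trace := by
    simp [hA, trace_add, trace_smul, trace_one]
  rw [e] at hreg
  have e1 := mul_le_mul_of_nonneg_left htrace hε.le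
  have e2 : η ^ 2 * (c₂ * H₂.trace) ≤ η ^ 2 * c₂ :=
    mul_le_mul_of_nonneg_left (by nlinarith) (sq_nonneg η)
  linarith

end Combine
section Infima

theorem le_of_forall_pos_le_add_mul {y A C : ℝ} (hC : 0 ≤ C)
    (h : ∀ δ, 0 < δ → y ≤ A + δ * C) : y ≤ A := by
  refine le_of_forall_pos_le_add fun e he => ?_
  have hC1 : 0 < C + 1 := by linarith
  refine (h (e / (C + 1)) (by positivity)).trans ?_
  have : e / (C + 1) * C ≤ e := by
    rw [div_mul_eq_mul_div, div_le_iff₀ hC1]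
    nlinarith
  linarith

theorem le_add_mul_sInf {s : Set ℝ} (hs : s.Nonempty) {y A B : ℝ} (hB : 0 ≤ B)
    (h : ∀ a ∈ s, y ≤ A + B * a) : y ≤ A + B * sInf s := by
  refine le_of_forall_pos_le_add_mul hB fun δ hδ => ?_
  obtain ⟨a, ha, hlt⟩ := Real.lt_sInf_add_pos hs hδ
  have := h a ha
  nlinarith

variable {d : ℕ}

theorem smoothness_nonneg (f : EuclideanSpace ℝ (Fin d) → ℝ)
    (K : Subalgebra ℝ (Matrix (Fin d) (Fin d) ℝ)) :
    0 ≤ smoothness f {H | H.PosSemidef ∧ H ∈ K} := by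
  refine Real.sInf_nonneg ?_
  rintro _ ⟨H, hH, rfl⟩
  exact hH.2.2.1.1.trace_nonneg

theorem noiseLevel_nonneg (𝓗 : Set (Matrix (Fin d) (Fin d) ℝ)) (S : Matrix (Fin d) (Fin d) ℝ) :
    0 ≤ noiseLevel 𝓗 S := by
  refine Real.sInf_nonneg ?_
  rintro _ ⟨H, -, rfl⟩
  exact Real.sqrt_nonneg _

theorem exists_posDef_trace_le_one (hd : 0 < d) (K : Subalgebra ℝ (Matrix (Fin d) (Fin d) ℝ)) :
    ∃ H : Matrix (Fin d) (Fin d) ℝ, H ∈ {H | H.PosSemidef ∧ H ∈ K} ∧ H.PosDef ∧ H.trace ≤ 1 := by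
  have hd' : (0 : ℝ) < d := by exact_mod_cast hd
  have hp : ((d : ℝ)⁻¹ • (1 : Matrix (Fin d) (Fin d) ℝ)).PosDef := PosDef.one.smul (inv_pos.2 hd')
  refine ⟨_, ⟨hp.posSemidef, K.smul_mem K.one_mem _⟩, hp, ?_⟩
  simp [trace_smul, trace_one, hd'.ne']

end Infima

/-! ### The expected total excess. -/

section Expectation

open MeasureTheory ProbabilityTheory

variable {d T : ℕ} {K : Subalgebra ℝ (Matrix (Fin d) (Fin d) ℝ)}
  {X : Set (EuclideanSpace ℝ (Fin d))} {ε η : ℝ} {x₁ : EuclideanSpace ℝ (Fin d)}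
  {Ω : Type*} [MeasurableSpace Ω] {μ : Measure Ω} [IsProbabilityMeasure μ]
  {ℓ : Fin T → Ω → DiffFun d} {L : EuclideanSpace ℝ (Fin d) → ℝ}
  {S : Matrix (Fin d) (Fin d) ℝ} {xs : EuclideanSpace ℝ (Fin d)}
  {x : Fin (T + 1) → Ω → EuclideanSpace ℝ (Fin d)}

/-- The expected total excess of the iterates, with free parameters. -/
theorem sum_integral_excess_le (hT : 0 < T) (hX : Convex ℝ X) (hXb : Bornology.IsBounded X)
    (hmeas : ∀ t, Measurable (ℓ t)) (hindep : iIndepFun (fun t ω => (ℓ t ω).1) μ)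
    (hconv : ∀ t ω, ConvexOn ℝ Set.univ (ℓ t ω).1)
    (h1 : Differentiable ℝ L) (h2 : Differentiable ℝ (fderiv ℝ L)) (hS : S.PosSemidef)
    (hnoise : ∀ t, NoiseBounded μ X L S fun ω => (ℓ t ω).1)
    (hxs : xs ∈ X) (hmin : ∀ y, L xs ≤ L y)
    (hε : 0 < ε) (hη : 0 < η) (hηD : η = √2 * domainNorm {H | H.PosSemidef ∧ H ∈ K} X)
    (hx₁ : x₁ ∈ X)
    (hx : ∀ ω, IsRun {H | H.PosSemidef ∧ H ∈ K} X ε η x₁ (fun t => (ℓ t ω).1) (fun t => x t ω))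
    {H₂ H₃ : Matrix (Fin d) (Fin d) ℝ}
    (hH₂ : H₂.PosDef) (hK₂ : H₂ ∈ K) (htr : H₂.trace ≤ 1) (hH₃ : H₃.PosDef) (hK₃ : H₃ ∈ K)
    (hhess : ∀ x, LoewnerLE (hessian L x) H₃) {c₁ c₂ : ℝ} (hc₁ : 0 < c₁) (hc₂ : 0 < c₂) :
    ∑ t : Fin T, ∫ ω, (L (x t.castSucc ω) - L xs) ∂μ ≤
      2 * (ε * (d / c₁) + η ^ 2 * (c₁ * d) + η ^ 2 * c₂ + 4 * η ^ 2 * H₃.trace +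
        c₂⁻¹ * (T * frobInner S H₂⁻¹)) := by
  have hg := continuous_gradient h2
  have hxm : ∀ t, Measurable (x t) := fun t =>
    IsRun.measurable_iterate hX hε hη.ne' hx t fun s _ => hmeas s
  have hxX : ∀ t ω, x t ω ∈ X := fun t ω => (hx ω).mem hx₁ t
  have hind : ∀ t : Fin T, IndepFun (ℓ t) (x t.castSucc) μ := fun t =>
    IsRun.indepFun_iterate hX hε hη.ne' hmeas hindep hx t
  have hexc : ∀ t : Fin T, Integrable (fun ω => L (x t.castSucc ω) - L xs) μ := fun t =>
    (integrable_comp_of_bounded h1.continuous hXb (hxm _) (hxX _)).sub (integrable_const _)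
  have hR := fun t : Fin T => NoiseBounded.integral_excess_le (hmeas t) (hxm t.castSucc) (hind t)
    hXb (hxX _) (hnoise t) hS h1 hg (hconv t) hxs
  have hN := fun t : Fin T => NoiseBounded.integral_quad_le_of_indepFun (hmeas t)
    (hxm t.castSucc) (hind t) (hxX _) (hnoise t) hS hg hH₂.inv.posSemidef
  have hsumR := Finset.sum_le_sum fun (t : Fin T) (_ : t ∈ Finset.univ) => (hR t).2
  have hsumN := Finset.sum_le_sum fun (t : Fin T) (_ : t ∈ Finset.univ) => (hN t).2
  simp only [Finset.sum_const, Finset.card_univ, Fintype.card_fin, nsmul_eq_mul] at hsumN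
  rw [← integral_finsetSum _ fun t _ => (hR t).1] at hsumR
  have i1 : Integrable (fun ω => ∑ t : Fin T,
      (gradient (ℓ t ω).1 (x t.castSucc ω) - gradient L (x t.castSucc ω)).ofLp ⬝ᵥ
        (H₂⁻¹ *ᵥ (gradient (ℓ t ω).1 (x t.castSucc ω) - gradient L (x t.castSucc ω)).ofLp)) μ :=
    integrable_finsetSum _ fun t _ => (hN t).1
  have i2 : Integrable (fun ω => ∑ t : Fin T, (L (x t.castSucc ω) - L xs)) μ :=
    integrable_finsetSum _ fun t _ => hexc t
  -- Half of the expected excess reappears on the right; moving it to the left produces the factor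
  -- `2`.
  have hpath := integral_mono (integrable_finsetSum _ fun t _ => (hR t).1)
    (((integrable_const (ε * (d / c₁) + η ^ 2 * (c₁ * d) + η ^ 2 * c₂ + 4 * η ^ 2 * H₃.trace)).add
      (i1.const_mul c₂⁻¹)).add (i2.div_const 2)) fun ω =>
    (hx ω).regret_le_noise hT hX hXb hε hη hηD hx₁ h1 h2 hxs hmin hH₂ hK₂ htr hH₃ hK₃ hhess
      hc₁ hc₂
  rw [integral_add' ((integrable_const _).add (i1.const_mul c₂⁻¹)) (i2.div_const 2),
    integral_add' (integrable_const _) (i1.const_mul c₂⁻¹), integral_const, integral_const_mul,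
    integral_div, integral_finsetSum _ fun t _ => (hN t).1,
    integral_finsetSum _ fun t _ => hexc t] at hpath
  simp only [probReal_univ, one_smul] at hpath
  have hc := mul_le_mul_of_nonneg_left hsumN (inv_nonneg.2 hc₂.le)
  linarith

/-- The expected total excess of the iterates, for a competitor of the noise level and a
smoothness matrix. -/
theorem sum_integral_excess_le_sqrt (hT : 0 < T) (hX : Convex ℝ X) (hXb : Bornology.IsBounded X)
    (hmeas : ∀ t, Measurable (ℓ t)) (hindep : iIndepFun (fun t ω => (ℓ t ω).1) μ)
    (hconv : ∀ t ω, ConvexOn ℝ Set.univ (ℓ t ω).1) (hS : S.PosSemidef)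
    (hnoise : ∀ t, NoiseBounded μ X L S fun ω => (ℓ t ω).1)
    (hxs : xs ∈ X) (hmin : ∀ y, L xs ≤ L y)
    (hε : 0 < ε) (hη : 0 < η) (hηD : η = √2 * domainNorm {H | H.PosSemidef ∧ H ∈ K} X)
    (hx₁ : x₁ ∈ X)
    (hx : ∀ ω, IsRun {H | H.PosSemidef ∧ H ∈ K} X ε η x₁ (fun t => (ℓ t ω).1) (fun t => x t ω))
    {H₂ Hs : Matrix (Fin d) (Fin d) ℝ} (hH₂ : H₂.PosDef) (hK₂ : H₂ ∈ K) (htr : H₂.trace ≤ 1)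
    (hHs : IsSmoothnessMatrix L {H | H.PosSemidef ∧ H ∈ K} Hs) :
    ∑ t : Fin T, ∫ ω, (L (x t.castSucc ω) - L xs) ∂μ ≤
      4 * η * d * √ε + 4 * η * (√T * √(frobInner S H₂⁻¹)) + 8 * η ^ 2 * Hs.trace := by
  obtain ⟨h1, h2, ⟨hHp, hHK⟩, hhess⟩ := hHs
  -- The slack `δ` makes `Hs + δ I` positive definite and keeps `c₂` positive when the noise term
  -- vanishes.
  refine le_of_forall_pos_le_add_mul (C := 2 * η + 8 * η ^ 2 * d) (by positivity) fun δ hδ => ?_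
  have hsε : 0 < √ε := Real.sqrt_pos.2 hε
  have ha : 0 ≤ frobInner S H₂⁻¹ := frobInner_nonneg hS hH₂.inv.posSemidef
  set r := √T * √(frobInner S H₂⁻¹) with hr
  have hr0 : 0 ≤ r := by positivity
  have hr2 : r ^ 2 = T * frobInner S H₂⁻¹ := by
    rw [hr, mul_pow, Real.sq_sqrt (Nat.cast_nonneg _), Real.sq_sqrt ha]
  have hδp : (δ • (1 : Matrix (Fin d) (Fin d) ℝ)).PosDef := PosDef.one.smul hδ
  have h := sum_integral_excess_le hT hX hXb hmeas hindep hconv h1 h2 hS hnoise hxs hmin hε hη hηD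
    hx₁ hx hH₂ hK₂ htr (PosDef.posSemidef_add hHp hδp)
    (K.add_mem hHK (K.smul_mem K.one_mem _)) (fun y => by
      have : Hs + δ • (1 : Matrix (Fin d) (Fin d) ℝ) - hessian L y =
        (Hs - hessian L y) + δ • 1 := by abel
      rw [LoewnerLE, this]
      exact PosSemidef.add (hhess y).2 hδp.posSemidef)
    -- These balance `ε d / c₁` with `η² c₁ d`, and, up to `δ`, `r² / c₂` with `η² c₂`.
    (c₁ := √ε / η) (c₂ := (r + δ) / η) (by positivity) (by positivity)
  have e1 : ε * (d / (√ε / η)) = η * d * √ε := by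
    nth_rewrite 1 [← Real.mul_self_sqrt hε.le]
    field_simp
  have e2 : η ^ 2 * (√ε / η * d) = η * d * √ε := by field_simp
  have e3 : η ^ 2 * ((r + δ) / η) = η * (r + δ) := by field_simp
  have e4 : ((r + δ) / η)⁻¹ * r ^ 2 ≤ η * r := by
    rw [inv_div, div_mul_eq_mul_div, div_le_iff₀ (by positivity)]
    nlinarith [mul_nonneg (mul_nonneg hη.le hr0) hδ.le]
  have e5 : (Hs + δ • (1 : Matrix (Fin d) (Fin d) ℝ)).trace = Hs.trace + δ * d := by
    simp [trace_add, trace_smul, trace_one]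
  rw [e1, e2, e3, e5, ← hr2] at h
  linarith

end Expectation
end AdaReg
end

theorem mainTheorem4 {d T : ℕ} (hT : 0 < T)
    {Ω : Type*} [MeasurableSpace Ω] (μ : MeasureTheory.Measure Ω)
    [MeasureTheory.IsProbabilityMeasure μ]
    (𝓗 : Set (Matrix (Fin d) (Fin d) ℝ)) (h𝓗 : AdaReg.IsWellStructured 𝓗)
    (X : Set (EuclideanSpace ℝ (Fin d))) (hXconv : Convex ℝ X) (hXbdd : Bornology.IsBounded X)
    (ℓ : Fin T → Ω → EuclideanSpace ℝ (Fin d) → ℝ)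
    (hmeas : ∀ t, Measurable (ℓ t)) (hindep : ProbabilityTheory.iIndepFun ℓ μ)
    (hconv : ∀ t ω, ConvexOn ℝ Set.univ (ℓ t ω)) (hdiff : ∀ t ω, Differentiable ℝ (ℓ t ω))
    (L : EuclideanSpace ℝ (Fin d) → ℝ) (hL : ∃ Hs, AdaReg.IsSmoothnessMatrix L 𝓗 Hs)
    (S : Matrix (Fin d) (Fin d) ℝ) (hS : S.PosSemidef)
    (hnoise : ∀ t, AdaReg.NoiseBounded μ X L S (ℓ t))
    (xs : EuclideanSpace ℝ (Fin d)) (hxs : xs ∈ X) (hmin : ∀ y, L xs ≤ L y)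
    (ε : ℝ) (hε : 0 < ε) (η : ℝ) (hη : η = √2 * AdaReg.domainNorm 𝓗 X)
    (x₁ : EuclideanSpace ℝ (Fin d)) (hx₁ : x₁ ∈ X)
    (x : Fin (T + 1) → Ω → EuclideanSpace ℝ (Fin d))
    (hx : ∀ ω, AdaReg.IsRun 𝓗 X ε η x₁ (fun t => ℓ t ω) (fun t => x t ω)) :
    MeasureTheory.Integrable
        (fun ω => L ((T : ℝ)⁻¹ • ∑ t : Fin T, x t.castSucc ω) - L xs) μ ∧
      ∫ ω, (L ((T : ℝ)⁻¹ • ∑ t : Fin T, x t.castSucc ω) - L xs) ∂μ ≤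
        16 / (T : ℝ) * AdaReg.domainNorm 𝓗 X ^ 2 * AdaReg.smoothness L 𝓗
          + 4 * √2 / √(T : ℝ) * AdaReg.domainNorm 𝓗 X * AdaReg.noiseLevel 𝓗 S
          + 4 * √2 * (d : ℝ) * √ε / (T : ℝ) * AdaReg.domainNorm 𝓗 X := by
  open AdaReg MeasureTheory in
  obtain ⟨K, rfl⟩ := h𝓗
  set D := domainNorm {H | H.PosSemidef ∧ H ∈ K} X with hD
  have hD0 : 0 ≤ D := domainNorm_nonneg _
  have hsm := smoothness_nonneg L K
  have hnl := noiseLevel_nonneg {H | H.PosSemidef ∧ H ∈ K} S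
  have hTr : (0 : ℝ) < T := by exact_mod_cast hT
  -- In dimension zero `η` vanishes but so does the excess; otherwise `η > 0`.
  rcases Nat.eq_zero_or_pos d with rfl | hd
  · have hz : ∀ ω, L ((T : ℝ)⁻¹ • ∑ t : Fin T, x t.castSucc ω) - L xs = 0 := fun ω => by
      rw [Subsingleton.elim ((T : ℝ)⁻¹ • ∑ t : Fin T, x t.castSucc ω) xs, sub_self]
    simp only [hz]
    refine ⟨integrable_const _, ?_⟩
    rw [integral_zero]
    positivity
  · obtain ⟨ω₀⟩ : Nonempty Ω := nonempty_of_isProbabilityMeasure μ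
    have hη0 : 0 < η := by
      refine lt_of_le_of_ne (by rw [hη]; positivity) (Ne.symm ?_)
      exact (hx ω₀).eta_ne_zero hd hT hε
    set ℓ' : Fin T → Ω → DiffFun d := fun t ω => ⟨ℓ t ω, hdiff t ω⟩ with hℓ'
    have hmeas' : ∀ t, Measurable (ℓ' t) := fun t => (hmeas t).subtype_mk
    have hxm : ∀ t, Measurable (x t) := fun t =>
      IsRun.measurable_iterate (ℓ := ℓ') hXconv hε hη0.ne' hx t fun s _ => hmeas' s
    have hxX : ∀ t ω, x t ω ∈ X := fun t ω => (hx ω).mem hx₁ t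
    have hLc : Continuous L := hL.choose_spec.1.continuous
    have hwt : ∑ _t : Fin T, (T : ℝ)⁻¹ = 1 := by simp [hTr.ne']
    have havg : Integrable (fun ω => L ((T : ℝ)⁻¹ • ∑ t : Fin T, x t.castSucc ω) - L xs) μ := by
      have hsum : Measurable fun ω => ∑ t : Fin T, x t.castSucc ω :=
        Finset.measurable_sum _ fun t _ => hxm _
      refine (integrable_comp_of_bounded hLc hXbdd (hsum.const_smul (T : ℝ)⁻¹) fun ω => ?_).sub
        (integrable_const _)
      simp only [Pi.smul_apply]
      rw [Finset.smul_sum]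
      exact hXconv.sum_mem (fun _ _ => by positivity) hwt fun t _ => hxX _ ω
    refine ⟨havg, ?_⟩
    have hexc : ∀ t : Fin T, Integrable (fun ω => L (x t.castSucc ω) - L xs) μ := fun t =>
      (integrable_comp_of_bounded hLc hXbdd (hxm _) (hxX _)).sub (integrable_const _)
    have hLconv : ConvexOn ℝ X L := (hnoise ⟨0, hT⟩).convexOn hXconv (hconv ⟨0, hT⟩)
    have hjensen : ∫ ω, (L ((T : ℝ)⁻¹ • ∑ t : Fin T, x t.castSucc ω) - L xs) ∂μ ≤
        (T : ℝ)⁻¹ * ∑ t : Fin T, ∫ ω, (L (x t.castSucc ω) - L xs) ∂μ := by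
      rw [← integral_finsetSum _ fun t _ => hexc t, ← integral_const_mul]
      refine integral_mono havg ((integrable_finsetSum _ fun t _ => hexc t).const_mul _) fun ω => ?_
      have := hLconv.map_sum_le (t := Finset.univ) (w := fun _ : Fin T => (T : ℝ)⁻¹)
        (p := fun t => x t.castSucc ω) (fun _ _ => by positivity) hwt fun t _ => hxX _ ω
      rw [← Finset.smul_sum, ← Finset.smul_sum, smul_eq_mul] at this
      simp only [Finset.sum_sub_distrib, Finset.sum_const, Finset.card_univ, Fintype.card_fin,
        nsmul_eq_mul, mul_sub]
      rw [inv_mul_cancel_left₀ hTr.ne']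
      linarith
    have hη2 : η ^ 2 = 2 * D ^ 2 := by rw [hη, mul_pow, Real.sq_sqrt zero_le_two]
    have hbound : ∀ a ∈ (fun H => √(frobInner S H⁻¹)) ''
        {H | H ∈ {H | H.PosSemidef ∧ H ∈ K} ∧ H.PosDef ∧ H.trace ≤ 1},
        ∀ b ∈ Matrix.trace '' {Hs | IsSmoothnessMatrix L {H | H.PosSemidef ∧ H ∈ K} Hs},
        ∫ ω, (L ((T : ℝ)⁻¹ • ∑ t : Fin T, x t.castSucc ω) - L xs) ∂μ ≤
          (4 * √2 * (d : ℝ) * √ε / (T : ℝ) * D + 4 * √2 / √(T : ℝ) * D * a) +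
            16 / (T : ℝ) * D ^ 2 * b := by
      rintro _ ⟨H₂, ⟨⟨-, hK₂⟩, hH₂, htr⟩, rfl⟩ _ ⟨Hs, hHs, rfl⟩
      have h := sum_integral_excess_le_sqrt (ℓ := ℓ') hT hXconv hXbdd hmeas' hindep hconv hS hnoise
        hxs hmin hε hη0 hη hx₁ hx hH₂ hK₂ htr hHs
      refine hjensen.trans ((mul_le_mul_of_nonneg_left h (by positivity)).trans_eq ?_)
      have hsT : (0 : ℝ) < √T := Real.sqrt_pos.2 hTr
      have e : (T : ℝ)⁻¹ * √T = (√T)⁻¹ := by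
        rw [inv_mul_eq_div, Real.sqrt_div_self', one_div]
      rw [hη2, hη]
      calc (T : ℝ)⁻¹ * (4 * (√2 * D) * d * √ε + 4 * (√2 * D) * (√T * √(frobInner S H₂⁻¹)) +
            8 * (2 * D ^ 2) * Hs.trace) = 4 * √2 * (d : ℝ) * √ε * (T : ℝ)⁻¹ * D +
              4 * √2 * ((T : ℝ)⁻¹ * √T) * D * √(frobInner S H₂⁻¹) +
              16 * (T : ℝ)⁻¹ * D ^ 2 * Hs.trace := by ring
        _ = _ := by rw [e]; simp only [div_eq_mul_inv]
    have hne : ((fun H => √(frobInner S H⁻¹)) ''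
        {H | H ∈ {H | H.PosSemidef ∧ H ∈ K} ∧ H.PosDef ∧ H.trace ≤ 1}).Nonempty :=
      Set.Nonempty.image _ (exists_posDef_trace_le_one hd K)
    have hneL : {Hs | IsSmoothnessMatrix L {H | H.PosSemidef ∧ H ∈ K} Hs}.Nonempty := hL
    -- The bound is affine in each of `a` and `b` with nonnegative slopes, so the infima are taken
    -- one after the other and need not be attained.
    have hfin := le_add_mul_sInf (hneL.image Matrix.trace)
      (B := 16 / (T : ℝ) * D ^ 2) (by positivity) fun b hb =>
        (le_add_mul_sInf hne (B := 4 * √2 / √(T : ℝ) * D)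
          (A := 4 * √2 * (d : ℝ) * √ε / (T : ℝ) * D + 16 / (T : ℝ) * D ^ 2 * b) (by positivity)
          fun a ha => (hbound a ha b hb).trans_eq (by ring)).trans_eq (add_right_comm _ _ _)
    rw [smoothness, noiseLevel]
    linarith
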